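/- Let $k$ be a field of characteristic $2$ and let $n\ge 0$ be an integer. Grade the polynomial ring $R=k[x_1,\dots,x_n]$ by $\mathbb{Z}[\tfrac12]$ with $|x_i|=\frac{2^i-1}{2^i}$, and let $\mathcal{E}_n(2)=\mathsf{Int}(R)=\bigoplus_{m\in\mathbb{Z}}R_m\subseteq R$ be the subalgebra spanned by the homogeneous elements of integer degree, regarded as a $\mathbb{Z}$-graded $k$-algebra. Then: 1. $\mathcal{E}_n(2)$ is an integral domain, and it is a Gorenstein ring (it is Noetherian, and its localization at every prime ideal has finite injective dimension as a module over itself). 2. The elements $y_i=x_i^{2^i}$, $1\le i\le n$, lie in $\mathcal{E}_n(2)$ and are homogeneous of degree $2^i-1$. They form a homogeneous system of parameters (that is, $\mathcal{E}_n(2)$ has Krull dimension $n$ and is a finitely generated module over $k[y_1,\dots,y_n]$), and $y_1,\dots,y_n$ is a regular sequence in $\mathcal{E}_n(2)$. 3. Let $Q=\mathcal{E}_n(2)/(y_1,\dots,y_n)$ with the induced $\mathbb{Z}$-grading. Then $\dim_k Q=2^{n(n-1)/2}$, and $Q$ is a graded Frobenius algebra with dualising element the class of $$\alpha=x_1x_2^3x_3^7\cdots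 x_{n-1}^{2^{n-1}-1}x_n^{2^n-2}\in\mathcal{E}_n(2)$$ in degree $d=2^{n+1}-2n-2$. That is, $Q_d$ is spanned by the class of $\alpha$, and there is a linear form $\varphi\colon Q\to k$ that vanishes on $Q_m$ for $m\ne d$, satisfies $\varphi(\alpha)=1$, and makes the pairing $(a,b)\mapsto\varphi(ab)$ nondegenerate. The socle of $Q$ (the sum of its minimal nonzero ideals) is the ideal generated by the class of $\alpha$. 4. Every homogeneous component $\mathcal{E}_n(2)_m$ is finite dimensional, and the Poincaré series $f(q)=\sum_{d\ge 0}q^d\dim_k\mathcal{E}_n(2)_d$ is (the power series expansion of) a rational function of $q$ satisfying $f(1/q)=(-q)^nf(q)$. -/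

import Mathlib

universe u

/-! ### Rings graded by `ℤ[1/2]` and their integral part -/

/-- The ring `ℤ[1/2]`, as the subring of the rational numbers `r` such that `r * 2 ^ e` is an
integer for some natural number `e`. -/
def ZHalf : Subring ℚ where
  carrier := {r | ∃ (e : ℕ) (m : ℤ), r * 2 ^ e = m}
  mul_mem' := by
    rintro a b ⟨e, m, h⟩ ⟨f, l, h'⟩
    exact ⟨e + f, m * l, by push_cast; rw [← h, ← h']; ring⟩
  one_mem' := ⟨0, 1, by simp⟩
  add_mem' := by
    rintro a b ⟨e, m, h⟩ ⟨f, l, h'⟩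
    exact ⟨e + f, m * 2 ^ f + l * 2 ^ e, by push_cast; rw [← h, ← h']; ring⟩
  zero_mem' := ⟨0, 0, by simp⟩
  neg_mem' := by
    rintro a ⟨e, m, h⟩
    exact ⟨e, -m, by push_cast; rw [← h]; ring⟩

section IntegralPart

variable {k A : Type*} [Field k] [CommRing A] [Algebra k A]

/-- The integral part `Int(A) = ⨁_{m ∈ ℤ} A_m` of a `ℤ[1/2]`-graded algebra `A`,
as a subalgebra of `A`. -/
def integralPart (𝒜 : ZHalf → Submodule k A) [SetLike.GradedMonoid 𝒜] : Subalgebra k A :=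
  (⨆ m : ℤ, 𝒜 (m : ZHalf)).toSubalgebra
    (Submodule.mem_iSup_of_mem (0 : ℤ) (by
      rw [Int.cast_zero]; exact SetLike.GradedOne.one_mem))
    (by
      intro x y hx hy
      induction hx using Submodule.iSup_induction' with
      | zero => simp
      | add x x' _ _ h h' => rw [add_mul]; exact add_mem h h'
      | mem i x hx =>
        induction hy using Submodule.iSup_induction' with
        | zero => simp
        | add y y' _ _ h h' => rw [mul_add]; exact add_mem h h'
        | mem j y hy =>
          refine Submodule.mem_iSup_of_mem (i + j) ?_
          rw [Int.cast_add]
          exact SetLike.GradedMul.mul_mem hx hy)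

/-- The `ℤ`-grading of the integral part: `Int(A)_m = A_m` for an integer `m`. -/
def integralGrading (𝒜 : ZHalf → Submodule k A) [SetLike.GradedMonoid 𝒜] (m : ℤ) :
    Submodule k (integralPart 𝒜) :=
  (𝒜 (m : ZHalf)).comap (integralPart 𝒜).val.toLinearMap

instance integralGrading_gradedMonoid (𝒜 : ZHalf → Submodule k A) [SetLike.GradedMonoid 𝒜] :
    SetLike.GradedMonoid (integralGrading 𝒜) where
  one_mem := by
    change (1 : A) ∈ 𝒜 ((0 : ℤ) : ZHalf)
    rw [Int.cast_zero]; exact SetLike.GradedOne.one_mem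
  mul_mem i j x y hx hy := by
    change ((x : A) * (y : A)) ∈ 𝒜 ((i + j : ℤ) : ZHalf)
    rw [Int.cast_add]; exact SetLike.GradedMul.mul_mem hx hy

theorem integralGrading_isInternal (𝒜 : ZHalf → Submodule k A) [SetLike.GradedMonoid 𝒜]
    (h : DirectSum.IsInternal 𝒜) : DirectSum.IsInternal (integralGrading 𝒜) := by
  have hinj : Function.Injective (integralPart 𝒜).val.toLinearMap := Subtype.val_injective
  have hle : ∀ m : ℤ, 𝒜 (m : ZHalf) ≤ LinearMap.range (integralPart 𝒜).val.toLinearMap := by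
    intro m x hx
    exact ⟨⟨x, Submodule.mem_iSup_of_mem m hx⟩, rfl⟩
  have hmap : ∀ m : ℤ, (integralGrading 𝒜 m).map (integralPart 𝒜).val.toLinearMap
      = 𝒜 (m : ZHalf) := fun m => by
    rw [integralGrading, Submodule.map_comap_eq, inf_eq_right.mpr (hle m)]
  apply DirectSum.isInternal_submodule_of_iSupIndep_of_iSup_eq_top
  · have hi : iSupIndep fun m : ℤ => 𝒜 (m : ZHalf) :=
      h.submodule_iSupIndep.comp (f := fun m : ℤ => (m : ZHalf)) Int.cast_injective
    intro m
    have := hi m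
    simp only [← hmap, ← Submodule.map_iSup] at this
    rw [disjoint_iff] at this ⊢
    rw [← Submodule.map_inf _ hinj] at this
    exact Submodule.map_injective_of_injective hinj (by rw [this, Submodule.map_bot])
  · apply Submodule.map_injective_of_injective hinj
    rw [Submodule.map_iSup]
    simp only [hmap]
    ext x
    constructor
    · intro hx
      exact ⟨⟨x, hx⟩, trivial, rfl⟩
    · rintro ⟨y, -, rfl⟩
      exact y.2

end IntegralPart

/-! ### The algebra `ℰ_n(2)` -/

/-- The degree `|x_i| = (2^i - 1) / 2^i`; the variable `x_i` has index `i - 1` in `Fin n`. -/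
def xDegree (n : ℕ) (i : Fin n) : ZHalf :=
  ⟨(2 ^ (i.val + 1) - 1) / 2 ^ (i.val + 1), i.val + 1, 2 ^ (i.val + 1) - 1, by
    push_cast; field_simp⟩

/-- The component of degree `d` of the `ℤ[1/2]`-graded polynomial algebra `k[x_1, …, x_n]`. -/
noncomputable def polyGrading (k : Type u) [Field k] (n : ℕ) (d : ZHalf) :
    Submodule k (MvPolynomial (Fin n) k) :=
  MvPolynomial.weightedHomogeneousSubmodule k (xDegree n) d

instance polyGrading_gradedMonoid (k : Type u) [Field k] (n : ℕ) :
    SetLike.GradedMonoid (polyGrading k n) :=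
  MvPolynomial.WeightedHomogeneousSubmodule.gradedMonoid (R := k) (w := xDegree n)

theorem polyGrading_isInternal (k : Type u) [Field k] (n : ℕ) :
    DirectSum.IsInternal (polyGrading k n) := by
  let _ : DirectSum.Decomposition (polyGrading k n) :=
    MvPolynomial.weightedDecomposition k (xDegree n)
  exact DirectSum.Decomposition.isInternal _

/-- `ℰ_n(2) = Int(k[x_1, …, x_n])` where `|x_i| = (2^i - 1) / 2^i`. -/
noncomputable abbrev E2 (k : Type u) [Field k] (n : ℕ) : Subalgebra k (MvPolynomial (Fin n) k) :=
  integralPart (polyGrading k n)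

/-- The homogeneous part of degree `m` of `ℰ_n(2)`. -/
noncomputable abbrev E2Grading (k : Type u) [Field k] (n : ℕ) : ℤ → Submodule k (E2 k n) :=
  integralGrading (polyGrading k n)

/-- `ℰ_n(2)` is a `ℤ`-graded algebra. -/
noncomputable instance E2.gradedAlgebra (k : Type u) [Field k] (n : ℕ) :
    GradedAlgebra (E2Grading k n) where
  toGradedMonoid := integralGrading_gradedMonoid _
  toDecomposition := DirectSum.IsInternal.chooseDecomposition _
    (integralGrading_isInternal _ (polyGrading_isInternal k n))

/-- The exponents `1, 3, …, 2^(n-1) - 1, 2^n - 2` of `x_1, …, x_n` in the dualising element. -/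
def socleExponent (n : ℕ) (i : Fin n) : ℕ :=
  if i.val + 1 = n then 2 ^ n - 2 else 2 ^ (i.val + 1) - 1

/-! ### Commutative algebra -/

open CategoryTheory in
/-- A commutative ring is Gorenstein if it is Noetherian and the localization at each prime ideal
has finite injective dimension as a module over itself. -/
def IsGorensteinRing (R : Type u) [CommRing R] : Prop :=
  IsNoetherianRing R ∧ ∀ (P : Ideal R) [P.IsPrime], ∃ d : ℕ,
    HasInjectiveDimensionLE
      (ModuleCat.of (Localization.AtPrime P) (Localization.AtPrime P)) d

/-- `y_1, …, y_n` is a homogeneous system of parameters, of degrees `d_1, …, d_n`, of the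
graded `k`-algebra `A`: the `y_i` are homogeneous of positive degree, `n` is the Krull dimension
of `A`, and `A` is a finitely generated module over `k[y_1, …, y_n]`. -/
structure IsHomogeneousSystemOfParameters {k A : Type*} [Field k] [CommRing A] [Algebra k A]
    (𝒜 : ℤ → Submodule k A) {n : ℕ} (y : Fin n → A) (d : Fin n → ℤ) : Prop where
  degree_pos : ∀ i, 0 < d i
  mem : ∀ i, y i ∈ 𝒜 (d i)
  krullDim : ringKrullDim A = n
  finite : Module.Finite (Algebra.adjoin k (Set.range y)) A

/-- `A = ⨁ A_m` is a graded Frobenius algebra with dualising element `α` in degree `d`: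
it is a finite dimensional graded algebra, `A_d` is spanned by `α`, and the linear form
that vanishes outside degree `d` and takes the value `1` at `α` induces
a nondegenerate pairing `(a, b) ↦ φ (a * b)`. -/
structure IsGradedFrobenius {k A : Type*} [Field k] [CommRing A] [Algebra k A]
    (𝒜 : ℤ → Submodule k A) (d : ℤ) (α : A) : Prop where
  gradedMonoid : SetLike.GradedMonoid 𝒜
  isInternal : DirectSum.IsInternal 𝒜
  finite : Module.Finite k A
  span_eq : 𝒜 d = Submodule.span k {α}
  exists_form : ∃ φ : A →ₗ[k] k, (∀ m, m ≠ d → ∀ a ∈ 𝒜 m, φ a = 0) ∧ φ α = 1 ∧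
    ∀ a, (∀ b, φ (a * b) = 0) → a = 0

/-- The socle of a commutative ring: the sum of its simple (that is, minimal nonzero) ideals. -/
def ringSocle (A : Type*) [CommRing A] : Ideal A :=
  sSup {I : Ideal A | IsSimpleModule A I}

/-- The grading induced on the quotient of a graded algebra by an ideal (to be used for
homogeneous ideals): `(A / I)_m` is the image of `A_m`. -/
def quotientGrading {k A : Type*} [Field k] [CommRing A] [Algebra k A]
    (𝒜 : ℤ → Submodule k A) (I : Ideal A) (m : ℤ) : Submodule k (A ⧸ I) :=
  (𝒜 m).map (Ideal.Quotient.mkₐ k I).toLinearMap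

/-- The Poincaré series `∑_{d ≥ 0} q^d dim A_d` of a graded algebra
with finite dimensional homogeneous parts. -/
noncomputable def poincareSeries {k A : Type*} [Field k] [CommRing A] [Algebra k A]
    (𝒜 : ℤ → Submodule k A) : PowerSeries ℚ :=
  PowerSeries.mk fun d : ℕ => (Module.finrank k (𝒜 (d : ℤ)) : ℚ)

/-!
Write `x ^ a` for the monomial with exponent `a`. The monomial `x ^ a` has integral degree iff
`∑ a_i / 2 ^ i` is an integer, and `ℰ_n(2)` is spanned over `k` by these monomials. Dividing the
exponents `a_i` by `2 ^ i` with remainder shows that it is free over `S = k[y_1, …, y_n]`, on the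
monomials with exponent in the *box*, that is, of integral degree with `a_i < 2 ^ i`
(`E2.span_boxMonomial`). Integrality determines `a_n` modulo `2 ^ n` from the other `a_i`,
so the box has `2 ^ (n (n - 1) / 2)` elements (`card_boxExponent`); it also forces `a_n` to be even,
so the exponent `c` of the dualising element is the greatest element of the box, and `a ↦ c - a` is
an involution of the box (`IsBoxExponent.le_socleExp`, `boxDual`). This involution is behind
the Gorenstein and Frobenius properties and the symmetry of the Poincaré series.

*Gorenstein property.* Let `φ : ℰ_n(2) → S` take the coefficient of `x ^ c` in the monomial basis.
For `a` and `b` in the box, `φ (x ^ a * x ^ (c - b))` is `1` if `a = b` and `0` otherwise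
(`frobeniusForm_boxMonomial_mul`). Hence `ℰ_n(2)` is isomorphic to `Hom_S(ℰ_n(2), S)` as a module
over itself. The functor `Hom_S(ℰ_n(2), -)` is exact and preserves injectives, so the injective
dimension of `ℰ_n(2)` is at most that of `S` (`hasInjectiveDimensionLE_of_dualFamily`). The latter
is finite by Hilbert's syzygy theorem, proved by coextension of scalars from `R` to `R[X]`
(`hasInjectiveDimensionLE_polynomial`), and localization at a prime does not increase it.

*Parameters and the quotient.* An element lies in the ideal generated by some of the `y_j` iff each
monomial in it is divisible by one of these `y_j` (`mem_span_y_iff`), so the `y_i` form a regular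
sequence, and the box gives a basis of the quotient `Q`. There multiplication by `x ^ (c - b)` moves
the coefficient at `b` to the coefficient at `c`, which is nondegeneracy. If `b` has least degree
among the exponents in the box that occur in `f`, then all other terms of `f * x ^ (c - b)` die in
`Q`, as `c` is the only exponent of maximal degree in the box; so every nonzero ideal of `Q`
contains the class of `x ^ c` (`exists_mul_eq_alpha`).

*Poincaré series.* Bounding the coordinate `a_j` by `2 ^ j` multiplies the generating function of a
set of exponents by `1 - q ^ (2 ^ j - 1)` (`partialSeries_succ`). So the Poincaré series is the
polynomial `∑ q ^ |b|`, over `b` in the box, divided by `∏ (1 - q ^ (2 ^ i - 1))`. The numerator is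
palindromic by the involution, and comparing degrees gives the functional equation.
-/

/-! ### Injective dimension and coextension of scalars -/

open CategoryTheory in
/-- Coextension of scalars `Hom_R(A, -)` along a ring homomorphism that makes `A` a projective
`R`-module is exact and preserves injectives, so it does not increase injective dimensions. -/
theorem hasInjectiveDimensionLE_coextendScalars {R A : Type u} [CommRing R] [CommRing A]
    (f : R →+* A)
    [Module.Projective R ((ModuleCat.restrictScalars f).obj (ModuleCat.of A A))]
    (d : ℕ) (M : ModuleCat.{u} R) (hM : HasInjectiveDimensionLE M d) :
    HasInjectiveDimensionLE ((ModuleCat.coextendScalars.{u, u, u} f).obj M) d := by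
  have hinj (I : ModuleCat.{u} R) (hI : Injective I) :
      Injective ((ModuleCat.coextendScalars.{u, u, u} f).obj I) :=
    (ModuleCat.restrictCoextendScalarsAdj.{u, u, u} f).map_injective I hI
  induction d generalizing M with
  | zero =>
    simp only [HasInjectiveDimensionLE, zero_add, ← injective_iff_hasInjectiveDimensionLT_one]
      at hM ⊢
    exact hinj M hM
  | succ d ih =>
    let ⟨I, hI, g, _⟩ := EnoughInjectives.presentation M
    have hg : Function.Injective g.hom := (ModuleCat.mono_iff_injective g).mp ‹_›
    let T : ShortComplex (ModuleCat.{u} R) :=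
      ModuleCat.shortComplexOfCompEqZero _ _ g.hom.exact_map_mkQ_range.linearMap_comp_eq_zero
    have hT : T.ShortExact := ModuleCat.shortComplex_shortExact T
      g.hom.exact_map_mkQ_range hg (Submodule.mkQ_surjective _)
    let T' : ShortComplex (ModuleCat.{u} A) :=
      ShortComplex.mk ((ModuleCat.coextendScalars.{u, u, u} f).map T.f)
        ((ModuleCat.coextendScalars.{u, u, u} f).map T.g) (by
          rw [← Functor.map_comp, T.zero]
          ext x
          rfl)
    have hT' : T'.ShortExact := by
      apply ModuleCat.shortComplex_shortExact
      · intro x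
        constructor
        · intro hx
          have hx' (s : A) : ∃ m, g.hom m = ModuleCat.CoextendScalars.equiv f I x s := by
            have h1 := congrArg
              (fun z => ModuleCat.CoextendScalars.equiv f (ModuleCat.of R _) z s) hx
            exact (g.hom.exact_map_mkQ_range _).mp h1
          refine ⟨(ModuleCat.CoextendScalars.equiv f M).symm
            ((LinearEquiv.ofInjective g.hom hg).symm.toLinearMap ∘ₗ
              (ModuleCat.CoextendScalars.equiv f I x).codRestrict
                (LinearMap.range g.hom) hx'), ?_⟩
          apply ModuleCat.CoextendScalars.ext
          ext s
          exact congrArg Subtype.val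
            ((LinearEquiv.ofInjective g.hom hg).apply_symm_apply
              ⟨ModuleCat.CoextendScalars.equiv f I x s, hx' s⟩)
        · rintro ⟨y, rfl⟩
          apply ModuleCat.CoextendScalars.ext
          ext s
          exact (g.hom.exact_map_mkQ_range _).mpr ⟨_, rfl⟩
      · intro x y hxy
        apply ModuleCat.CoextendScalars.ext
        ext s
        exact hg (congrArg (fun z => ModuleCat.CoextendScalars.equiv f I z s) hxy)
      · intro x
        obtain ⟨h, hh⟩ := Module.projective_lifting_property
          (LinearMap.range g.hom).mkQ (ModuleCat.CoextendScalars.equiv f _ x)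
          (Submodule.mkQ_surjective _)
        refine ⟨(ModuleCat.CoextendScalars.equiv f _).symm h, ?_⟩
        apply ModuleCat.CoextendScalars.ext
        exact hh
    have h3 := ih T.X₃ ((hT.hasInjectiveDimensionLT_X₃_iff d hI).mpr hM)
    exact (hT'.hasInjectiveDimensionLT_X₃_iff d (hinj _ hI)).mp h3

section Frobenius

variable {R A : Type u} [CommRing R] [CommRing A] [Algebra R A]
  {ι : Type*} [Fintype ι] [DecidableEq ι]

/-- A spanning family that has a dual family for the bilinear form `(a, b) ↦ φ (a * b)`
is a basis. -/
noncomputable def basisOfDualFamily (e f : ι → A) (φ : A →ₗ[R] R)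
    (he : Submodule.span R (Set.range e) = ⊤)
    (h : ∀ i j, φ (e i * f j) = if i = j then 1 else 0) : Module.Basis ι R A :=
  Module.Basis.mk (v := e) (by
    rw [Fintype.linearIndependent_iff]
    intro g hg j
    have := congrArg (fun x => φ (x * f j)) hg
    simpa [Finset.sum_mul, h] using this) he.ge

open CategoryTheory in
/-- If the form `(a, b) ↦ φ (a * b)` makes `A` a free Frobenius extension of `R`, then
`A` is isomorphic to `Hom_R(A, R)` over `A`, so the injective dimension of `A` is at most
that of `R`. -/
theorem hasInjectiveDimensionLE_of_dualFamily (e f : ι → A) (φ : A →ₗ[R] R)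
    (he : Submodule.span R (Set.range e) = ⊤) (hf : Submodule.span R (Set.range f) = ⊤)
    (h : ∀ i j, φ (e i * f j) = if i = j then 1 else 0)
    (d : ℕ) (hR : HasInjectiveDimensionLE (ModuleCat.of R R) d) :
    HasInjectiveDimensionLE (ModuleCat.of A A) d := by
  let b := basisOfDualFamily e f φ he h
  have hb (i : ι) : b i = e i := by simp [b, basisOfDualFamily]
  let A' := (ModuleCat.restrictScalars (algebraMap R A)).obj (ModuleCat.of A A)
  let t : A ≃ₗ[R] A' :=
    { AddEquiv.refl A with
      map_smul' := fun r a => by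
        change r • a = algebraMap R A r * a
        exact Algebra.smul_def r a }
  have : Module.Projective R A := Module.Projective.of_basis b
  have : Module.Projective R A' := Module.Projective.of_equiv t
  have hco := hasInjectiveDimensionLE_coextendScalars (algebraMap R A) d (ModuleCat.of R R) hR
  let F : A →ₗ[A] (ModuleCat.coextendScalars.{u, u, u} (algebraMap R A)).obj (ModuleCat.of R R) :=
    { toFun := fun a => (ModuleCat.CoextendScalars.equiv _ _).symm
        ((φ ∘ₗ LinearMap.mulRight R a) ∘ₗ t.symm.toLinearMap)
      map_add' := fun x y => by
        apply ModuleCat.CoextendScalars.ext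
        refine LinearMap.ext fun (s : A) => ?_
        change φ (s * (x + y)) = φ (s * x) + φ (s * y)
        rw [mul_add, map_add]
      map_smul' := fun x y => by
        apply ModuleCat.CoextendScalars.ext
        refine LinearMap.ext fun (s : A) => ?_
        change φ (s * (x * y)) = φ ((s * x) * y)
        rw [mul_assoc] }
  have hF (a s : A) : ModuleCat.CoextendScalars.equiv (algebraMap R A) (ModuleCat.of R R) (F a) s
    = φ (s * a) := rfl
  have hbij : Function.Bijective F := by
    constructor
    · rw [injective_iff_map_eq_zero]
      intro a ha
      have ha' (s : A) : φ (s * a) = 0 := by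
        rw [← hF, ha]; rfl
      obtain ⟨c, rfl⟩ := (Submodule.mem_span_range_iff_exists_fun R).mp
        (hf ▸ Submodule.mem_top : a ∈ Submodule.span R (Set.range f))
      have hc (i : ι) : c i = 0 := by
        simpa [Finset.mul_sum, h] using ha' (e i)
      simp [hc]
    · intro ψ
      let ψ' : A →ₗ[R] R := (ModuleCat.CoextendScalars.equiv (algebraMap R A) _ ψ) ∘ₗ t.toLinearMap
      refine ⟨∑ j, ψ' (e j) • f j, ?_⟩
      apply ModuleCat.CoextendScalars.ext
      have hlin : φ ∘ₗ LinearMap.mulRight R (∑ j, ψ' (e j) • f j) = ψ' := by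
        refine b.ext fun i => ?_
        simp [hb, Finset.mul_sum, h]
      ext s
      exact LinearMap.congr_fun hlin s
  exact hasInjectiveDimensionLT_of_iso (LinearEquiv.ofBijective F hbij).toModuleIso.symm _

end Frobenius

section Syzygy

open CategoryTheory Polynomial

theorem hasInjectiveDimensionLE_of_ringEquiv {R S : Type u} [CommRing R] [CommRing S] (e : R ≃+* S)
    (d : ℕ) (hR : ∀ M : ModuleCat.{u} R, HasInjectiveDimensionLE M d) (N : ModuleCat.{u} S) :
    HasInjectiveDimensionLE N d := by
  let _ := RingHomInvPair.of_ringEquiv e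
  let _ := RingHomInvPair.symm (RingHomClass.toRingHom e) (RingHomClass.toRingHom e.symm)
  let M : ModuleCat.{u} R := (ModuleCat.restrictScalars e.toRingHom).obj N
  let t : M ≃ₛₗ[RingHomClass.toRingHom e] N :=
    { AddEquiv.refl N with map_smul' := fun _ _ => rfl }
  exact (ModuleCat.hasInjectiveDimensionLE_iff_of_semiLinearEquiv e t d).mp (hR M)

/-- If every `R`-module has injective dimension at most `d`, then every `R[X]`-module `N` has
injective dimension at most `d + 1`, by the exact sequence
`0 → N → Hom_R(R[X], N) → Hom_R(R[X], N) → 0`, where the first map sends `x` to `p ↦ p • x` and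
the second one sends `ψ` to `p ↦ ψ (X * p) - X • ψ p`. -/
theorem hasInjectiveDimensionLE_polynomial {R : Type u} [CommRing R] (d : ℕ)
    (hR : ∀ M : ModuleCat.{u} R, HasInjectiveDimensionLE M d) (N : ModuleCat.{u} R[X]) :
    HasInjectiveDimensionLE N (d + 1) := by
  let f : R →+* R[X] := C
  let A' := (ModuleCat.restrictScalars f).obj (ModuleCat.of R[X] R[X])
  let t : R[X] ≃ₗ[R] A' :=
    { AddEquiv.refl R[X] with
      map_smul' := fun r a => by
        change r • a = C r * a
        exact smul_eq_C_mul r }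
  have : Module.Projective R A' := Module.Projective.of_equiv t
  let N' : ModuleCat.{u} R := (ModuleCat.restrictScalars f).obj N
  let H : ModuleCat.{u} R[X] := (ModuleCat.coextendScalars.{u, u, u} f).obj N'
  have hH : HasInjectiveDimensionLE H d := hasInjectiveDimensionLE_coextendScalars f d N' (hR N')
  let ev (ψ : H) (p : R[X]) : N := ModuleCat.CoextendScalars.equiv f N' ψ p
  have ext' {ψ θ : H} (h : ∀ p, ev ψ p = ev θ p) : ψ = θ :=
    ModuleCat.CoextendScalars.ext (LinearMap.ext h)
  have ev_add (ψ : H) (p q : R[X]) : ev ψ (p + q) = ev ψ p + ev ψ q :=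
    map_add (ModuleCat.CoextendScalars.equiv f N' ψ) p q
  have ev_C (ψ : H) (r : R) (p : R[X]) : ev ψ (C r * p) = C r • ev ψ p :=
    map_smul (ModuleCat.CoextendScalars.equiv f N' ψ) r (show A' from p)
  let mk (g : R[X] → N) (ha : ∀ p q, g (p + q) = g p + g q)
      (hs : ∀ r p, g (C r * p) = C r • g p) : H :=
    (ModuleCat.CoextendScalars.equiv f N').symm
      { toFun := g, map_add' := ha, map_smul' := hs }
  let i : N →ₗ[R[X]] H :=
    { toFun := fun x => mk (fun p => p • x) (fun p q => add_smul _ _ _) (fun r p => mul_smul _ _ _)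
      map_add' := fun x y => ext' fun p => smul_add p x y
      map_smul' := fun q x => ext' fun p => by
        change p • q • x = (p * q) • x
        rw [mul_smul] }
  let δ : H →ₗ[R[X]] H :=
    { toFun := fun ψ => mk (fun p => ev ψ (X * p) - (X : R[X]) • ev ψ p)
        (fun p q => by rw [mul_add, ev_add, ev_add, smul_add]; abel)
        (fun r p => by
          rw [mul_left_comm, ev_C, ev_C, smul_sub, smul_smul, smul_smul, mul_comm X (C r)])
      map_add' := fun ψ θ => ext' fun p => by
        change (ev ψ (X * p) + ev θ (X * p)) - (X : R[X]) • (ev ψ p + ev θ p) =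
          (ev ψ (X * p) - (X : R[X]) • ev ψ p) + (ev θ (X * p) - (X : R[X]) • ev θ p)
        rw [smul_add]; abel
      map_smul' := fun q ψ => ext' fun p => by
        change ev ψ (X * p * q) - (X : R[X]) • ev ψ (p * q) =
          ev ψ (X * (p * q)) - (X : R[X]) • ev ψ (p * q)
        rw [mul_assoc] }
  have hi (x : N) (p : R[X]) : ev (i x) p = p • x := rfl
  have hδ (ψ : H) (p : R[X]) : ev (δ ψ) p = ev ψ (X * p) - (X : R[X]) • ev ψ p := rfl
  have h0 (p : R[X]) : ev 0 p = 0 := rfl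
  have i_inj : Function.Injective i := fun x y hxy => by
    simpa [hi] using congrArg (fun ψ => ev ψ 1) hxy
  have exact : Function.Exact i δ := by
    intro ψ
    constructor
    · intro h
      have hX (p : R[X]) : ev ψ (X * p) = (X : R[X]) • ev ψ p := by
        rw [← sub_eq_zero, ← hδ, h, h0]
      refine ⟨ev ψ 1, ext' fun p => ?_⟩
      rw [hi]
      induction p using Polynomial.induction_on' with
      | add p q hp hq => rw [add_smul, hp, hq, ev_add]
      | monomial m r =>
        rw [← C_mul_X_pow_eq_monomial, mul_smul, ev_C]
        congr 1
        induction m with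
        | zero => rw [pow_zero, one_smul]
        | succ m ih => rw [pow_succ', mul_smul, hX, ih]
    · rintro ⟨x, rfl⟩
      refine ext' fun p => ?_
      rw [hδ, hi, hi, mul_smul, sub_self, h0]
  have δ_surj : Function.Surjective δ := by
    intro θ
    -- The conditions `ψ 1 = 0` and `ψ (X ^ (m + 1)) = X • ψ (X ^ m) + θ (X ^ m)` define `ψ`.
    let g (m : ℕ) : N := Nat.rec 0 (fun m x => (X : R[X]) • x + ev θ (X ^ m)) m
    let G : R[X] → N := fun p => p.sum fun m r => C r • g m
    have G_mon (m : ℕ) (r : R) : G (C r * X ^ m) = C r • g m := by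
      change Polynomial.sum _ _ = _
      rw [C_mul_X_pow_eq_monomial, sum_monomial_index]
      simp
    have G_add (p q : R[X]) : G (p + q) = G p + G q :=
      sum_add_index p q _ (fun _ => by simp) (fun _ _ _ => by rw [C_add, add_smul])
    have G_C (r : R) (p : R[X]) : G (C r * p) = C r • G p := by
      induction p using Polynomial.induction_on' with
      | add p q hp hq => rw [mul_add, G_add, G_add, hp, hq, smul_add]
      | monomial m s =>
        rw [← C_mul_X_pow_eq_monomial, G_mon, ← mul_assoc, ← C_mul, G_mon, C_mul, mul_smul]
    refine ⟨mk G G_add G_C, ext' fun p => ?_⟩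
    rw [hδ]
    change G (X * p) - (X : R[X]) • G p = ev θ p
    induction p using Polynomial.induction_on' with
    | add p q hp hq =>
      rw [mul_add, G_add, G_add, ev_add, ← hp, ← hq, smul_add]; abel
    | monomial m r =>
      rw [← C_mul_X_pow_eq_monomial, G_mon, mul_left_comm, ← pow_succ', G_mon, ev_C]
      change C r • ((X : R[X]) • g m + ev θ (X ^ m)) - (X : R[X]) • C r • g m = _
      rw [smul_add, smul_comm (X : R[X]), add_sub_cancel_left]
  let T : ShortComplex (ModuleCat.{u} R[X]) :=
    ModuleCat.shortComplexOfCompEqZero i δ exact.linearMap_comp_eq_zero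
  have hT : T.ShortExact := ModuleCat.shortComplex_shortExact T exact i_inj δ_surj
  exact hT.hasInjectiveDimensionLT_X₁ (d + 1) hH
    (hasInjectiveDimensionLT_of_ge _ (d + 1) _ (by simp))

/-- Hilbert's syzygy theorem, for injective dimensions. -/
theorem hasInjectiveDimensionLE_mvPolynomial (k : Type u) [Field k] (n : ℕ)
    (M : ModuleCat.{u} (MvPolynomial (Fin n) k)) : HasInjectiveDimensionLE M n := by
  induction n with
  | zero =>
    refine hasInjectiveDimensionLE_of_ringEquiv
      (MvPolynomial.isEmptyRingEquiv k (Fin 0)).symm 0 (fun M => ?_) M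
    have : Module.Injective k M := Module.injective_of_isSemisimpleRing k M
    have : Injective M := Module.injective_object_of_injective_module k M
    exact inferInstance
  | succ n ih =>
    exact hasInjectiveDimensionLE_of_ringEquiv
      (MvPolynomial.finSuccEquiv k n).symm.toRingEquiv (n + 1)
      (hasInjectiveDimensionLE_polynomial n ih) M

end Syzygy

open CategoryTheory in
/-- A Noetherian ring of finite injective dimension over itself is Gorenstein, as localization
does not increase injective dimensions. -/
theorem isGorensteinRing_of_hasInjectiveDimensionLE {R : Type u} [CommRing R] [IsNoetherianRing R]
    (d : ℕ) (h : HasInjectiveDimensionLE (ModuleCat.of R R) d) : IsGorensteinRing R := by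
  refine ⟨inferInstance, fun P _ => ⟨d, ?_⟩⟩
  let M := ModuleCat.of R R
  have h1 : HasInjectiveDimensionLE (M.localizedModule P.primeCompl) d :=
    M.localizedModule_hasInjectiveDimensionLE d P.primeCompl
  have : IsLocalizedModule P.primeCompl (M.localizedModuleMkLinearMap P.primeCompl) :=
    M.localizedModule_isLocalizedModule P.primeCompl
  let t : M.localizedModule P.primeCompl ≃ₗ[Localization.AtPrime P]
      Localization.AtPrime P :=
    LinearEquiv.extendScalarsOfIsLocalization P.primeCompl (Localization.AtPrime P)
      (IsLocalizedModule.linearEquiv P.primeCompl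
        (M.localizedModuleMkLinearMap P.primeCompl)
        (Algebra.linearMap R (Localization.AtPrime P)))
  exact hasInjectiveDimensionLT_of_iso t.toModuleIso _

/-! ### Exponents of integral degree -/

section Exponents

variable {n : ℕ}

/-- The monomial with exponent `a` has integral degree. -/
def IsIntegralExponent (a : Fin n →₀ ℕ) : Prop :=
  ∃ m : ℤ, Finsupp.weight (xDegree n) a = (m : ZHalf)

theorem coe_weight (a : Fin n →₀ ℕ) :
    ((Finsupp.weight (xDegree n) a : ZHalf) : ℚ) =
      ∑ i, (a i : ℚ) * ((2 ^ (i.val + 1) - 1) / 2 ^ (i.val + 1)) := by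
  rw [Finsupp.weight_apply, Finsupp.sum_fintype _ (fun i c => c • xDegree n i) (by simp),
    AddSubmonoidClass.coe_finsetSum]
  refine Finset.sum_congr rfl fun i _ => ?_
  rw [nsmul_eq_mul]
  rfl

theorem weight_eq_intCast_iff (a : Fin n →₀ ℕ) (m : ℤ) :
    Finsupp.weight (xDegree n) a = (m : ZHalf) ↔
      ((Finsupp.weight (xDegree n) a : ZHalf) : ℚ) = m := by
  rw [← Subtype.val_injective.eq_iff, SubringClass.coe_intCast]

theorem coe_weight_nonneg (a : Fin n →₀ ℕ) :
    0 ≤ ((Finsupp.weight (xDegree n) a : ZHalf) : ℚ) := by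
  rw [coe_weight]
  refine Finset.sum_nonneg fun i _ => mul_nonneg (Nat.cast_nonneg _) (div_nonneg ?_ (by positivity))
  exact sub_nonneg.mpr (one_le_pow₀ (by norm_num))

/-- Every variable has degree at least `1 / 2`. -/
theorem sum_le_two_mul_coe_weight (a : Fin n →₀ ℕ) :
    ((∑ i, a i : ℕ) : ℚ) ≤ 2 * ((Finsupp.weight (xDegree n) a : ZHalf) : ℚ) := by
  rw [coe_weight, Finset.mul_sum, Nat.cast_sum]
  refine Finset.sum_le_sum fun i _ => ?_
  have h2 : (1 : ℚ) ≤ 2 ^ i.val := one_le_pow₀ (by norm_num)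
  have : (1 : ℚ) ≤ 2 * ((2 ^ (i.val + 1) - 1) / 2 ^ (i.val + 1)) := by
    rw [← mul_div_assoc, le_div_iff₀ (by positivity), pow_succ]
    linarith
  have ha : (0 : ℚ) ≤ a i := Nat.cast_nonneg _
  nlinarith

theorem finite_setOf_weight_eq (d : ZHalf) :
    {a : Fin n →₀ ℕ | Finsupp.weight (xDegree n) a = d}.Finite := by
  have hfin : Set.Finite {a : Fin n → ℕ | ∀ i, a i ≤ ⌊2 * (d : ℚ)⌋₊} := by
    refine (Set.Finite.pi' fun _ : Fin n => Set.finite_Iic ⌊2 * (d : ℚ)⌋₊).subset fun a ha i => ha i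
  refine (hfin.preimage (f := fun a : Fin n →₀ ℕ => (a : Fin n → ℕ))
    DFunLike.coe_injective.injOn).subset fun a ha i => Nat.le_floor ?_
  have h := sum_le_two_mul_coe_weight a
  rw [Set.mem_ofPred_eq.mp ha] at h
  exact (Nat.cast_le.mpr (Finset.single_le_sum (fun j _ => Nat.zero_le (a j))
    (Finset.mem_univ i))).trans h

theorem eq_zero_of_coe_weight_eq_zero {a : Fin n →₀ ℕ}
    (h : ((Finsupp.weight (xDegree n) a : ZHalf) : ℚ) = 0) : a = 0 := by
  have h1 := sum_le_two_mul_coe_weight a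
  rw [h, mul_zero] at h1
  have h2 : ∑ i, a i = 0 := by exact_mod_cast le_antisymm h1 (Nat.cast_nonneg _)
  ext i
  exact (Finset.sum_eq_zero_iff.mp h2) i (Finset.mem_univ i)

theorem isIntegralExponent_zero : IsIntegralExponent (0 : Fin n →₀ ℕ) := ⟨0, by simp⟩

theorem IsIntegralExponent.add {a b : Fin n →₀ ℕ} (ha : IsIntegralExponent a)
    (hb : IsIntegralExponent b) : IsIntegralExponent (a + b) := by
  obtain ⟨m, hm⟩ := ha
  obtain ⟨l, hl⟩ := hb
  exact ⟨m + l, by rw [map_add, hm, hl, Int.cast_add]⟩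

theorem isIntegralExponent_add_iff {a b : Fin n →₀ ℕ} (ha : IsIntegralExponent a) :
    IsIntegralExponent (a + b) ↔ IsIntegralExponent b := by
  refine ⟨fun ⟨l, hl⟩ => ?_, ha.add⟩
  obtain ⟨m, hm⟩ := ha
  refine ⟨l - m, ?_⟩
  rw [Int.cast_sub, ← hl, ← hm, map_add, add_sub_cancel_left]

theorem IsIntegralExponent.tsub {a b : Fin n →₀ ℕ} (ha : IsIntegralExponent a)
    (hb : IsIntegralExponent b) (h : b ≤ a) : IsIntegralExponent (a - b) := by
  rwa [← isIntegralExponent_add_iff hb, add_tsub_cancel_of_le h]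

/-- The exponent of `y_i = x_i ^ (2 ^ i)`, where `x_i` has index `i - 1` in `Fin n`. -/
noncomputable def yExponent (i : Fin n) : Fin n →₀ ℕ := Finsupp.single i (2 ^ (i.val + 1))

theorem weight_yExponent (i : Fin n) :
    Finsupp.weight (xDegree n) (yExponent i) = ((2 ^ (i.val + 1) - 1 : ℤ) : ZHalf) := by
  rw [weight_eq_intCast_iff, coe_weight, Finset.sum_eq_single i]
  · simp [yExponent, mul_div_cancel₀]
  · intro j _ hj
    simp [yExponent, hj.symm]
  · simp

theorem isIntegralExponent_yExponent (i : Fin n) : IsIntegralExponent (yExponent i) :=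
  ⟨_, weight_yExponent i⟩

theorem yExponent_le_iff (i : Fin n) (a : Fin n →₀ ℕ) :
    yExponent i ≤ a ↔ 2 ^ (i.val + 1) ≤ a i :=
  Finsupp.single_le_iff

/-- The degree of `x ^ a` is `∑ a_i - ∑ a_i / 2 ^ i`, and multiplying the second sum by `2 ^ n` makes
it an integer. -/
theorem isIntegralExponent_iff_dvd (a : Fin n →₀ ℕ) :
    IsIntegralExponent a ↔ 2 ^ n ∣ ∑ i, a i * 2 ^ (n - 1 - i.val) := by
  have key : ((Finsupp.weight (xDegree n) a : ZHalf) : ℚ) =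
      (∑ i, a i : ℕ) - (∑ i, a i * 2 ^ (n - 1 - i.val) : ℕ) / 2 ^ n := by
    rw [coe_weight, Nat.cast_sum, Nat.cast_sum, Finset.sum_div, ← Finset.sum_sub_distrib]
    refine Finset.sum_congr rfl fun i _ => ?_
    have h : (2 : ℚ) ^ n = 2 ^ (n - 1 - i.val) * 2 ^ (i.val + 1) := by
      rw [← pow_add]; congr 1; omega
    rw [h]
    push_cast
    field_simp
  constructor
  · rintro ⟨m, hm⟩
    rw [weight_eq_intCast_iff, key] at hm
    have h2 : ((∑ i, a i * 2 ^ (n - 1 - i.val) : ℕ) : ℚ) = 2 ^ n * ((∑ i, a i : ℕ) - m) := by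
      rw [← hm]; field_simp; ring
    have h3 : ((∑ i, a i * 2 ^ (n - 1 - i.val) : ℕ) : ℤ) = 2 ^ n * ((∑ i, a i : ℕ) - m) := by
      exact_mod_cast h2
    exact_mod_cast (Dvd.intro _ h3.symm : (2 ^ n : ℤ) ∣ _)
  · rintro ⟨l, hl⟩
    refine ⟨(∑ i, a i : ℕ) - l, ?_⟩
    rw [weight_eq_intCast_iff, key, hl]
    push_cast
    field_simp

/-- The exponents of integral degree that are not divisible by any `y_i`. -/
def IsBoxExponent (a : Fin n →₀ ℕ) : Prop :=
  IsIntegralExponent a ∧ ∀ i, a i < 2 ^ (i.val + 1)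

theorem exists_yExponent_le_of_not_isBoxExponent {a : Fin n →₀ ℕ} (ha : IsIntegralExponent a)
    (h : ¬ IsBoxExponent a) : ∃ i, yExponent i ≤ a := by
  by_contra! hc
  exact h ⟨ha, fun i => by simpa [yExponent_le_iff] using hc i⟩

/-- The last coordinate of an exponent of integral degree is determined modulo `2 ^ n` by the
other ones. -/
theorem isIntegralExponent_succ_iff {m : ℕ} (a : Fin (m + 1) →₀ ℕ) :
    IsIntegralExponent a ↔
      2 ^ (m + 1) ∣ 2 * (∑ i : Fin m, a i.castSucc * 2 ^ (m - 1 - i.val)) + a (Fin.last m) := by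
  rw [isIntegralExponent_iff_dvd, Fin.sum_univ_castSucc, Finset.mul_sum]
  have : ∀ i : Fin m, a i.castSucc * 2 ^ (m + 1 - 1 - (i.castSucc).val) =
      2 * (a i.castSucc * 2 ^ (m - 1 - i.val)) := by
    intro i
    have : m + 1 - 1 - (i.castSucc).val = m - 1 - i.val + 1 := by
      rw [Fin.val_castSucc]; omega
    rw [this, pow_succ]; ring
  rw [Finset.sum_congr rfl fun i _ => this i]
  simp only [Fin.val_last, add_tsub_cancel_right, tsub_self, pow_zero, mul_one]

instance finite_boxExponent : Finite {a : Fin n →₀ ℕ // IsBoxExponent a} := by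
  have hfin : Set.Finite {a : Fin n → ℕ | ∀ i, a i < 2 ^ (i.val + 1)} :=
    (Set.Finite.pi' fun i : Fin n => Set.finite_Iio (2 ^ (i.val + 1))).subset fun a ha i => ha i
  exact Set.Finite.to_subtype ((hfin.preimage (f := fun a : Fin n →₀ ℕ => (a : Fin n → ℕ))
    DFunLike.coe_injective.injOn).subset fun a ha i => ha.2 i)

noncomputable instance : Fintype {a : Fin n →₀ ℕ // IsBoxExponent a} := Fintype.ofFinite _

theorem sum_fin_add_one (m : ℕ) : ∑ i : Fin m, (i.val + 1) = (m + 1) * (m + 1 - 1) / 2 := by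
  rw [Fin.sum_univ_eq_sum_range (fun i => i + 1), ← Finset.sum_range_id_mul_two,
    Nat.mul_div_cancel _ two_pos, Finset.sum_range_succ']
  simp

theorem card_boxExponent :
    Fintype.card {a : Fin n →₀ ℕ // IsBoxExponent a} = 2 ^ (n * (n - 1) / 2) := by
  cases n with
  | zero =>
    rw [Nat.zero_mul, Nat.zero_div, pow_zero, Fintype.card_eq_one_iff]
    refine ⟨⟨0, isIntegralExponent_zero, fun i => i.elim0⟩, fun a => Subtype.ext ?_⟩
    exact Subsingleton.elim _ _
  | succ m =>
    -- Forgetting the last coordinate is a bijection onto the vectors `b` with `b_i < 2 ^ i`.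
    let r : {a : Fin (m + 1) →₀ ℕ // IsBoxExponent a} → (i : Fin m) → Fin (2 ^ (i.val + 1)) :=
      fun a i => ⟨a.1 i.castSucc, a.2.2 i.castSucc⟩
    have hr : Function.Bijective r := by
      constructor
      · rintro ⟨a, ha, ha'⟩ ⟨b, hb, hb'⟩ hab
        have h1 (i : Fin m) : a i.castSucc = b i.castSucc :=
          congrArg Fin.val (congrFun hab i)
        have h2 : a (Fin.last m) = b (Fin.last m) := by
          rw [isIntegralExponent_succ_iff] at ha hb
          simp_rw [h1] at ha
          refine Nat.ModEq.eq_of_lt_of_lt (Nat.ModEq.add_left_cancel'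
            (2 * ∑ i : Fin m, b i.castSucc * 2 ^ (m - 1 - i.val)) ?_)
            (ha' (Fin.last m)) (hb' (Fin.last m))
          exact ((Nat.modEq_zero_iff_dvd.mpr ha).trans (Nat.modEq_zero_iff_dvd.mpr hb).symm)
        refine Subtype.ext (Finsupp.ext fun i => ?_)
        exact Fin.lastCases h2 h1 i
      · intro b
        let s := 2 * ∑ i : Fin m, (b i).val * 2 ^ (m - 1 - i.val)
        let t := (2 ^ (m + 1) - s % 2 ^ (m + 1)) % 2 ^ (m + 1)
        have hpos : 0 < 2 ^ (m + 1) := by positivity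
        have hst : 2 ^ (m + 1) ∣ s + t := by
          have h1 : s % 2 ^ (m + 1) < 2 ^ (m + 1) := Nat.mod_lt _ hpos
          have h2 : s % 2 ^ (m + 1) + (2 ^ (m + 1) - s % 2 ^ (m + 1)) = 2 ^ (m + 1) := by omega
          rw [Nat.dvd_iff_mod_eq_zero, Nat.add_mod_mod, ← Nat.mod_add_mod, h2, Nat.mod_self]
        refine ⟨⟨Finsupp.equivFunOnFinite.symm
          (Fin.snoc (α := fun _ => ℕ) (fun i => (b i).val) t), ?_, ?_⟩, ?_⟩
        · rw [isIntegralExponent_succ_iff]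
          simpa using hst
        · intro i
          refine Fin.lastCases ?_ (fun i => ?_) i
          · simpa using Nat.mod_lt _ hpos
          · simp
        · funext i
          simp [r]
    rw [Fintype.card_congr (Equiv.ofBijective r hr), Fintype.card_pi]
    simp only [Fintype.card_fin, Finset.prod_pow_eq_pow_sum]
    rw [sum_fin_add_one]

variable (n) in
/-- The exponent of the dualising element. -/
noncomputable def socleExp : Fin n →₀ ℕ := Finsupp.equivFunOnFinite.symm (socleExponent n)

theorem socleExp_apply (i : Fin n) : socleExp n i = socleExponent n i := rfl

theorem coe_weight_socleExp :
    ((Finsupp.weight (xDegree n) (socleExp n) : ZHalf) : ℚ) = 2 ^ (n + 1) - 2 * n - 2 := by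
  rw [coe_weight]
  cases n with
  | zero => norm_num
  | succ m =>
    have h1 (i : Fin m) : socleExp (m + 1) i.castSucc = 2 ^ (i.val + 1) - 1 := by
      rw [socleExp_apply, socleExponent, if_neg (by have := i.2; simp; omega), Fin.val_castSucc]
    have h2 : socleExp (m + 1) (Fin.last m) = 2 ^ (m + 1) - 2 := by
      rw [socleExp_apply, socleExponent, if_pos (by simp)]
    have h3 (j : ℕ) : ((2 ^ (j + 1) - 1 : ℕ) : ℚ) = 2 ^ (j + 1) - 1 := by
      rw [Nat.cast_sub Nat.one_le_two_pow]; simp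
    have h4 : ((2 ^ (m + 1) - 2 : ℕ) : ℚ) = 2 ^ (m + 1) - 2 := by
      rw [Nat.cast_sub (by rw [pow_succ]; have := Nat.one_le_two_pow (n := m); omega)]; simp
    have h5 : ∑ i : Fin m, ((2 : ℚ) ^ (i.val + 1) - 1) * ((2 ^ (i.val + 1) - 1) / 2 ^ (i.val + 1)) =
        2 ^ (m + 1) - 2 * m - 1 - 1 / 2 ^ m := by
      rw [Fin.sum_univ_eq_sum_range
        (fun i => ((2 : ℚ) ^ (i + 1) - 1) * ((2 ^ (i + 1) - 1) / 2 ^ (i + 1)))]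
      induction m with
      | zero => norm_num
      | succ m ih =>
        rw [Finset.sum_range_succ, ih]
        · push_cast
          field_simp
          ring
        · intro i
          rw [socleExp_apply, socleExponent, if_neg (by have := i.2; simp; omega),
            Fin.val_castSucc]
        · rw [socleExp_apply, socleExponent, if_pos (by simp)]
        · rw [Nat.cast_sub (by rw [pow_succ]; have := Nat.one_le_two_pow (n := m); omega)]; simp
    rw [Fin.sum_univ_castSucc]
    simp only [h1, h2, h3, h4, Fin.val_castSucc, Fin.val_last]
    rw [h5]
    push_cast
    field_simp
    ring

theorem weight_socleExp :
    Finsupp.weight (xDegree n) (socleExp n) = ((2 ^ (n + 1) - 2 * n - 2 : ℤ) : ZHalf) := by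
  rw [weight_eq_intCast_iff, coe_weight_socleExp]
  push_cast
  rfl

/-- The exponent of the dualising element bounds the box: in the last coordinate, because this
coordinate of an exponent of integral degree is even. -/
theorem IsBoxExponent.le_socleExp {a : Fin n →₀ ℕ} (ha : IsBoxExponent a) : a ≤ socleExp n := by
  intro i
  rw [socleExp_apply, socleExponent]
  have hi := ha.2 i
  split_ifs with h
  · cases n with
    | zero => exact i.elim0
    | succ m =>
      obtain rfl : i = Fin.last m := Fin.ext (Nat.succ_injective h)
      have h1 := (isIntegralExponent_succ_iff a).mp ha.1
      have h2 : 2 ∣ 2 ^ (m + 1) := dvd_pow_self 2 (Nat.succ_ne_zero _)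
      have h3 : 2 ∣ a (Fin.last m) := (Nat.dvd_add_right (Dvd.intro _ rfl)).mp (h2.trans h1)
      rw [Fin.val_last] at hi
      omega
  · omega

theorem isBoxExponent_socleExp : IsBoxExponent (socleExp n) := by
  refine ⟨⟨_, weight_socleExp⟩, fun i => ?_⟩
  rw [socleExp_apply, socleExponent]
  have := Nat.one_le_two_pow (n := i.val + 1)
  split_ifs with h
  · rw [h] at this ⊢; omega
  · omega

theorem IsBoxExponent.socleExp_tsub {a : Fin n →₀ ℕ} (ha : IsBoxExponent a) :
    IsBoxExponent (socleExp n - a) :=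
  ⟨isBoxExponent_socleExp.1.tsub ha.1 ha.le_socleExp, fun i =>
    (Nat.sub_le _ _).trans_lt (isBoxExponent_socleExp.2 i)⟩

end Exponents

/-! ### Krull dimension of integral extensions -/

/-- An injective integral extension preserves the Krull dimension, by incomparability and
going up. -/
theorem ringKrullDim_eq_of_isIntegral_of_injective {R S : Type*} [CommRing R] [CommRing S]
    [Algebra R S] [Algebra.IsIntegral R S] (h : Function.Injective (algebraMap R S)) :
    ringKrullDim S = ringKrullDim R := by
  apply le_antisymm
  · exact Order.krullDim_le_of_strictMono (PrimeSpectrum.comap (algebraMap R S))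
      fun P Q hPQ => Ideal.IsIntegral.comap_lt_comap hPQ
  · refine iSup_le fun l => ?_
    obtain ⟨P, -, hP, hPl⟩ := Ideal.exists_ideal_over_prime_of_isIntegral (S := S)
      l.head.asIdeal ⊥ (by
        rw [← RingHom.ker_eq_comap_bot, (RingHom.injective_iff_ker_eq_bot _).mp h]
        exact bot_le)
    have : P.LiesOver (RelSeries.head l).asIdeal := ⟨hPl.symm⟩
    obtain ⟨L, hL, -⟩ := Ideal.exists_ltSeries_of_hasGoingUp l P
    rw [← hL]
    exact le_iSup (fun l : LTSeries (PrimeSpectrum S) => (l.length : WithBot ℕ∞)) L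

/-! ### The monomial basis of `ℰ_n(2)` -/

section Monomials

open MvPolynomial

variable {k : Type u} [Field k] {n : ℕ}

theorem mem_integralPart_iff (f : MvPolynomial (Fin n) k) :
    f ∈ integralPart (polyGrading k n) ↔ ∀ a, coeff a f ≠ 0 → IsIntegralExponent a := by
  constructor
  · intro hf
    induction hf using Submodule.iSup_induction' with
    | zero => simp
    | add x y _ _ hx hy =>
      intro a ha
      by_cases hxa : coeff a x = 0
      · exact hy a fun hya => ha (by rw [coeff_add, hxa, hya, add_zero])
      · exact hx a hxa
    | mem m _ hx => exact fun _ ha => ⟨m, hx ha⟩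
  · intro h
    rw [f.as_sum]
    refine Subalgebra.sum_mem _ fun a ha => ?_
    obtain ⟨m, hm⟩ := h a (mem_support_iff.mp ha)
    exact Submodule.mem_iSup_of_mem m (isWeightedHomogeneous_monomial _ _ _ hm)

theorem E2.isIntegralExponent (f : E2 k n) {a : Fin n →₀ ℕ} (h : coeff a f.1 ≠ 0) :
    IsIntegralExponent a :=
  (mem_integralPart_iff f.1).mp f.2 a h

theorem mem_E2Grading_iff (f : E2 k n) (m : ℤ) :
    f ∈ E2Grading k n m ↔
      ∀ a, coeff a f.1 ≠ 0 → Finsupp.weight (xDegree n) a = (m : ZHalf) :=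
  ⟨fun h _ ha => h ha, fun h a ha => h a ha⟩

variable (k) in
/-- The monomial of `ℰ_n(2)` with a given exponent of integral degree. -/
noncomputable def E2.monomial (a : Fin n →₀ ℕ) (ha : IsIntegralExponent a) : E2 k n :=
  ⟨MvPolynomial.monomial a 1, (mem_integralPart_iff _).mpr fun b hb => by
    classical
    rw [coeff_monomial] at hb
    obtain rfl : a = b := by by_contra h; simp [h] at hb
    exact ha⟩

theorem E2.coe_monomial (a : Fin n →₀ ℕ) (ha : IsIntegralExponent a) :
    (E2.monomial k a ha : MvPolynomial (Fin n) k) = MvPolynomial.monomial a 1 := rfl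

theorem E2.monomial_mul (a b : Fin n →₀ ℕ) (ha : IsIntegralExponent a)
    (hb : IsIntegralExponent b) :
    E2.monomial k a ha * E2.monomial k b hb = E2.monomial k (a + b) (ha.add hb) := by
  ext1
  simp [E2.coe_monomial]

theorem E2.as_sum (f : E2 k n) :
    f = ∑ a : f.1.support, coeff a.1 f.1 •
      E2.monomial k a.1 (E2.isIntegralExponent f (mem_support_iff.mp a.2)) := by
  ext1
  rw [AddSubmonoidClass.coe_finsetSum]
  simp only [Subalgebra.coe_smul, E2.coe_monomial, smul_monomial, smul_eq_mul, mul_one]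
  rw [Finset.sum_coe_sort f.1.support fun a => MvPolynomial.monomial a (coeff a f.1)]
  exact f.1.as_sum

theorem E2.monomial_mem (a : Fin n →₀ ℕ) (ha : IsIntegralExponent a) {m : ℤ}
    (h : Finsupp.weight (xDegree n) a = (m : ZHalf)) : E2.monomial k a ha ∈ E2Grading k n m :=
  isWeightedHomogeneous_monomial _ _ _ h

variable (k) in
/-- The element `y_i = x_i ^ (2 ^ i)`. -/
noncomputable def E2.y (i : Fin n) : E2 k n :=
  E2.monomial k (yExponent i) (isIntegralExponent_yExponent i)

theorem E2.coe_y (i : Fin n) : (E2.y k i : MvPolynomial (Fin n) k) = X i ^ 2 ^ (i.val + 1) := by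
  rw [E2.y, E2.coe_monomial, X_pow_eq_monomial, yExponent]

/-- `ℰ_n(2)` as an algebra over the polynomial ring `k[y_1, …, y_n]`. -/
noncomputable instance E2.mvPolynomialAlgebra : Algebra (MvPolynomial (Fin n) k) (E2 k n) :=
  (aeval (E2.y k)).toAlgebra

theorem E2.algebraMap_eq :
    algebraMap (MvPolynomial (Fin n) k) (E2 k n) = (aeval (E2.y k)).toRingHom := rfl

instance : IsScalarTower k (MvPolynomial (Fin n) k) (E2 k n) :=
  IsScalarTower.of_algebraMap_eq fun r => by
    rw [E2.algebraMap_eq]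
    exact ((aeval (E2.y k)).commutes r).symm

/-- Division with remainder of an exponent by the exponents of the `y_i`: the quotient. -/
noncomputable def quoExponent (a : Fin n →₀ ℕ) : Fin n →₀ ℕ :=
  Finsupp.equivFunOnFinite.symm fun i => a i / 2 ^ (i.val + 1)

/-- Division with remainder of an exponent by the exponents of the `y_i`: the remainder. -/
noncomputable def remExponent (a : Fin n →₀ ℕ) : Fin n →₀ ℕ :=
  Finsupp.equivFunOnFinite.symm fun i => a i % 2 ^ (i.val + 1)

/-- The exponent of the monomial in the `x_i` obtained by substituting `y_i` for `x_i`. -/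
noncomputable def substExponent (t : Fin n →₀ ℕ) : Fin n →₀ ℕ :=
  Finsupp.equivFunOnFinite.symm fun i => 2 ^ (i.val + 1) * t i

theorem substExponent_apply (a : Fin n →₀ ℕ) (i : Fin n) :
    substExponent a i = 2 ^ (i.val + 1) * a i := rfl

theorem substExponent_quo_add_rem (a : Fin n →₀ ℕ) :
    substExponent (quoExponent a) + remExponent a = a := by
  ext i
  exact Nat.div_add_mod _ _

theorem substExponent_eq_sum (t : Fin n →₀ ℕ) : substExponent t = ∑ i, t i • yExponent i := by
  ext j
  rw [Finsupp.finsetSum_apply, Finset.sum_eq_single j]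
  · simp [substExponent_apply, yExponent, mul_comm]
  · intro i _ hij
    simp [yExponent, hij]
  · simp

theorem isIntegralExponent_substExponent (t : Fin n →₀ ℕ) :
    IsIntegralExponent (substExponent t) := by
  rw [substExponent_eq_sum]
  refine Finset.sum_induction _ _ (fun _ _ => IsIntegralExponent.add) isIntegralExponent_zero
    fun i _ => ?_
  induction t i with
  | zero => rw [zero_nsmul]; exact isIntegralExponent_zero
  | succ m ih => rw [succ_nsmul]; exact ih.add (isIntegralExponent_yExponent i)

theorem IsIntegralExponent.isBoxExponent_rem {a : Fin n →₀ ℕ} (ha : IsIntegralExponent a) :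
    IsBoxExponent (remExponent a) := by
  refine ⟨?_, fun i => Nat.mod_lt _ (by positivity)⟩
  rwa [← isIntegralExponent_add_iff (isIntegralExponent_substExponent (quoExponent a)),
    substExponent_quo_add_rem]

theorem quoExponent_subst_add (t a : Fin n →₀ ℕ) :
    quoExponent (substExponent t + a) = t + quoExponent a := by
  ext i
  exact Nat.mul_add_div (by positivity) _ _

theorem remExponent_subst_add (t a : Fin n →₀ ℕ) :
    remExponent (substExponent t + a) = remExponent a := by
  ext i
  exact Nat.mul_add_mod _ _ _

theorem E2.algebraMap_monomial (t : Fin n →₀ ℕ) :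
    algebraMap (MvPolynomial (Fin n) k) (E2 k n) (MvPolynomial.monomial t 1) =
      E2.monomial k (substExponent t) (isIntegralExponent_substExponent t) := by
  ext1
  rw [E2.coe_monomial, E2.algebraMap_eq]
  change (aeval (E2.y k) (MvPolynomial.monomial t (1 : k))).1 = _
  rw [aeval_monomial, map_one, one_mul, Finsupp.prod_fintype _ _ (by simp),
    SubmonoidClass.coe_finsetProd, substExponent_eq_sum, monomial_sum_one]
  refine Finset.prod_congr rfl fun i _ => ?_
  rw [SubmonoidClass.coe_pow, E2.y, E2.coe_monomial, monomial_pow, one_pow]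

variable (k n) in
/-- The family of monomials of `ℰ_n(2)` that are not divisible by any `y_i`. -/
noncomputable def E2.boxMonomial (b : {a : Fin n →₀ ℕ // IsBoxExponent a}) : E2 k n :=
  E2.monomial k b.1 b.2.1

theorem E2.span_boxMonomial :
    Submodule.span (MvPolynomial (Fin n) k) (Set.range (E2.boxMonomial k n)) = ⊤ := by
  rw [eq_top_iff]
  rintro f -
  rw [E2.as_sum f]
  refine Submodule.sum_mem _ fun a _ => ?_
  have ha := E2.isIntegralExponent f (mem_support_iff.mp a.2)
  have h : coeff a.1 f.1 • E2.monomial k a.1 ha =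
      (coeff a.1 f.1 • MvPolynomial.monomial (quoExponent a.1) (1 : k)) •
        E2.boxMonomial k n ⟨_, ha.isBoxExponent_rem⟩ := by
    rw [smul_assoc, Algebra.smul_def (MvPolynomial.monomial _ _), E2.algebraMap_monomial,
      E2.boxMonomial, E2.monomial_mul]
    simp only [substExponent_quo_add_rem]
  rw [h]
  exact Submodule.smul_mem _ _ (Submodule.subset_span ⟨_, rfl⟩)

open Classical in
variable (k n) in
/-- The `k`-linear map that sends `x ^ (c + substExponent t)` to `y ^ t`, where `c` is the
exponent of the dualising element, and all other monomials to zero. -/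
noncomputable def frobeniusAux : MvPolynomial (Fin n) k →ₗ[k] MvPolynomial (Fin n) k :=
  (basisMonomials (Fin n) k).constr k fun a =>
    if remExponent a = socleExp n then MvPolynomial.monomial (quoExponent a) 1 else 0

open Classical in
theorem frobeniusAux_monomial (a : Fin n →₀ ℕ) :
    frobeniusAux k n (MvPolynomial.monomial a 1) =
      if remExponent a = socleExp n then MvPolynomial.monomial (quoExponent a) 1 else 0 := by
  have := (basisMonomials (Fin n) k).constr_basis k (fun a =>
    if remExponent a = socleExp n then MvPolynomial.monomial (quoExponent a) (1 : k) else 0) a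
  rwa [coe_basisMonomials] at this

variable (k n) in
/-- The coefficient of the dualising element with respect to the basis of `ℰ_n(2)` over
`k[y_1, …, y_n]` given by the monomials `E2.boxMonomial`. -/
noncomputable def frobeniusForm : E2 k n →ₗ[MvPolynomial (Fin n) k] MvPolynomial (Fin n) k where
  toFun f := frobeniusAux k n f.1
  map_add' f g := map_add (frobeniusAux k n) f.1 g.1
  map_smul' s f := by
    classical
    have key (t a : Fin n →₀ ℕ) (ha : IsIntegralExponent a) :
        frobeniusAux k n (MvPolynomial.monomial t (1 : k) • E2.monomial k a ha).1 =
          MvPolynomial.monomial t 1 * frobeniusAux k n (E2.monomial k a ha).1 := by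
      rw [Algebra.smul_def, E2.algebraMap_monomial, E2.monomial_mul, E2.coe_monomial,
        E2.coe_monomial, frobeniusAux_monomial, frobeniusAux_monomial, remExponent_subst_add,
        quoExponent_subst_add]
      split_ifs <;> simp
    change frobeniusAux k n (s • f).1 = s * frobeniusAux k n f.1
    rw [E2.as_sum f, Finset.smul_sum, AddSubmonoidClass.coe_finsetSum,
      AddSubmonoidClass.coe_finsetSum, map_sum, map_sum, Finset.mul_sum]
    refine Finset.sum_congr rfl fun a _ => ?_
    rw [smul_comm, Subalgebra.coe_smul, Subalgebra.coe_smul, map_smul, map_smul, mul_smul_comm]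
    congr 1
    induction s using MvPolynomial.induction_on' with
    | add p q hp hq => rw [add_smul, Subalgebra.coe_add, map_add, hp, hq, add_mul]
    | monomial t r =>
      rw [← mul_one r, ← smul_eq_mul, ← smul_monomial, smul_assoc, Subalgebra.coe_smul, map_smul,
        key, smul_mul_assoc]

theorem frobeniusForm_monomial_eq_zero {a : Fin n →₀ ℕ} (ha : IsIntegralExponent a)
    (h : remExponent a ≠ socleExp n) : frobeniusForm k n (E2.monomial k a ha) = 0 := by
  classical
  exact (frobeniusAux_monomial a).trans (if_neg h)

theorem IsBoxExponent.remExponent_eq {a : Fin n →₀ ℕ} (ha : IsBoxExponent a) :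
    remExponent a = a := by
  ext i
  exact Nat.mod_eq_of_lt (ha.2 i)

theorem IsBoxExponent.quoExponent_eq {a : Fin n →₀ ℕ} (ha : IsBoxExponent a) :
    quoExponent a = 0 := by
  ext i
  exact Nat.div_eq_of_lt (ha.2 i)

theorem frobeniusForm_monomial_socleExp :
    frobeniusForm k n (E2.monomial k (socleExp n) isBoxExponent_socleExp.1) = 1 := by
  classical
  refine (frobeniusAux_monomial _).trans ?_
  rw [if_pos isBoxExponent_socleExp.remExponent_eq, isBoxExponent_socleExp.quoExponent_eq]
  rfl

/-- The involution `a ↦ c - a` of the box, where `c` is the exponent of the dualising element. -/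
noncomputable def boxDual (b : {a : Fin n →₀ ℕ // IsBoxExponent a}) :
    {a : Fin n →₀ ℕ // IsBoxExponent a} :=
  ⟨socleExp n - b.1, b.2.socleExp_tsub⟩

theorem add_boxDual (b : {a : Fin n →₀ ℕ // IsBoxExponent a}) :
    b.1 + (boxDual b).1 = socleExp n := add_tsub_cancel_of_le b.2.le_socleExp

theorem boxDual_boxDual (b : {a : Fin n →₀ ℕ // IsBoxExponent a}) : boxDual (boxDual b) = b :=
  Subtype.ext (tsub_tsub_cancel_of_le b.2.le_socleExp)

/-- The exponent `a` is determined by `a + (c - b)` modulo the exponents of the `y_i`. -/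
theorem remExponent_add_boxDual_eq_iff (a b : {a : Fin n →₀ ℕ // IsBoxExponent a}) :
    remExponent (a.1 + (boxDual b).1) = socleExp n ↔ a = b := by
  constructor
  · intro h
    refine Subtype.ext (Finsupp.ext fun i => ?_)
    have h1 : (a.1 i + (boxDual b).1 i) % 2 ^ (i.val + 1) = socleExp n i :=
      DFunLike.congr_fun h i
    have h2 : b.1 i + (boxDual b).1 i = socleExp n i := DFunLike.congr_fun (add_boxDual b) i
    have h3 : a.1 i + (boxDual b).1 i ≡ b.1 i + (boxDual b).1 i [MOD 2 ^ (i.val + 1)] := by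
      rw [Nat.ModEq, h1, h2, Nat.mod_eq_of_lt (isBoxExponent_socleExp.2 i)]
    exact (Nat.ModEq.add_right_cancel' _ h3).eq_of_lt_of_lt (a.2.2 i) (b.2.2 i)
  · rintro rfl
    rw [add_boxDual, isBoxExponent_socleExp.remExponent_eq]

open Classical in
theorem frobeniusForm_boxMonomial_mul (a b : {a : Fin n →₀ ℕ // IsBoxExponent a}) :
    frobeniusForm k n (E2.boxMonomial k n a * E2.boxMonomial k n (boxDual b)) =
      if a = b then 1 else 0 := by
  rw [E2.boxMonomial, E2.boxMonomial, E2.monomial_mul]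
  split_ifs with h
  · subst h
    simp only [add_boxDual]
    exact frobeniusForm_monomial_socleExp
  · exact frobeniusForm_monomial_eq_zero _ fun h' =>
      h ((remExponent_add_boxDual_eq_iff a b).mp h')

instance : Module.Finite (MvPolynomial (Fin n) k) (E2 k n) :=
  ⟨Submodule.fg_def.mpr ⟨_, Set.finite_range _, E2.span_boxMonomial⟩⟩

instance : IsNoetherianRing (E2 k n) :=
  IsNoetherianRing.of_finite (MvPolynomial (Fin n) k) (E2 k n)

theorem E2.isGorensteinRing : IsGorensteinRing (E2 k n) := by
  classical
  refine isGorensteinRing_of_hasInjectiveDimensionLE n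
    (hasInjectiveDimensionLE_of_dualFamily (E2.boxMonomial k n)
      (fun b => E2.boxMonomial k n (boxDual b)) (frobeniusForm k n) E2.span_boxMonomial ?_
      frobeniusForm_boxMonomial_mul n (hasInjectiveDimensionLE_mvPolynomial k n _))
  have hsurj : Function.Surjective (boxDual (n := n)) := fun b => ⟨boxDual b, boxDual_boxDual b⟩
  rw [← E2.span_boxMonomial, ← hsurj.range_comp (E2.boxMonomial k n)]
  rfl

theorem E2.algebraMap_injective :
    Function.Injective (algebraMap (MvPolynomial (Fin n) k) (E2 k n)) := by
  classical
  rw [injective_iff_map_eq_zero]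
  intro s hs
  have h := map_smul (frobeniusForm k n) s
    (E2.monomial k (socleExp n) isBoxExponent_socleExp.1)
  rwa [frobeniusForm_monomial_socleExp, Algebra.smul_def, hs, zero_mul, map_zero, smul_eq_mul,
    mul_one, eq_comm] at h

theorem E2.ringKrullDim : ringKrullDim (E2 k n) = n := by
  rw [ringKrullDim_eq_of_isIntegral_of_injective (E2.algebraMap_injective (k := k) (n := n)),
    MvPolynomial.ringKrullDim_of_isNoetherianRing, ringKrullDim_eq_zero_of_field, zero_add,
    Nat.card_fin]

theorem E2.finite_adjoin :
    Module.Finite (Algebra.adjoin k (Set.range (E2.y k (n := n)))) (E2 k n) := by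
  refine ⟨Submodule.fg_def.mpr ⟨_, Set.finite_range (E2.boxMonomial k n), ?_⟩⟩
  rw [eq_top_iff]
  rintro f -
  obtain ⟨c, rfl⟩ := (Submodule.mem_span_range_iff_exists_fun (MvPolynomial (Fin n) k)).mp
    ((E2.span_boxMonomial (k := k) (n := n)).ge (Submodule.mem_top (x := f)))
  refine Submodule.sum_mem _ fun b _ => ?_
  have hc : algebraMap (MvPolynomial (Fin n) k) (E2 k n) (c b) ∈
      Algebra.adjoin k (Set.range (E2.y k (n := n))) := by
    rw [Algebra.adjoin_range_eq_range_aeval]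
    exact ⟨c b, rfl⟩
  rw [Algebra.smul_def]
  exact Submodule.smul_mem _
    (⟨_, hc⟩ : Algebra.adjoin k (Set.range (E2.y k (n := n)))) (Submodule.subset_span ⟨b, rfl⟩)

theorem E2.y_mem (i : Fin n) : E2.y k i ∈ E2Grading k n (2 ^ (i.val + 1) - 1) :=
  E2.monomial_mem _ _ (weight_yExponent i)

theorem E2.isHomogeneousSystemOfParameters :
    IsHomogeneousSystemOfParameters (E2Grading k n) (E2.y k) fun i => 2 ^ (i.val + 1) - 1 where
  degree_pos _ := sub_pos.mpr (one_lt_pow₀ one_lt_two (Nat.succ_ne_zero _))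
  mem := E2.y_mem
  krullDim := E2.ringKrullDim
  finite := E2.finite_adjoin

end Monomials

/-! ### The regular sequence `y_1, …, y_n` -/

section RegularSequence

open MvPolynomial

variable {k : Type u} [Field k] {n : ℕ}

theorem E2.coeff_y_mul (i : Fin n) (f : E2 k n) (a : Fin n →₀ ℕ) :
    coeff (yExponent i + a) (E2.y k i * f).1 = coeff a f.1 := by
  rw [Subalgebra.coe_mul, E2.y, E2.coe_monomial, coeff_monomial_mul, one_mul]

theorem E2.coeff_y_mul_of_not_le (i : Fin n) (f : E2 k n) (a : Fin n →₀ ℕ)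
    (h : ¬ yExponent i ≤ a) : coeff a (E2.y k i * f).1 = 0 := by
  rw [Subalgebra.coe_mul, E2.y, E2.coe_monomial, coeff_monomial_mul', if_neg h]

/-- The ideal generated by some of the `y_j` is spanned by the monomials of `ℰ_n(2)` that are
divisible by one of them in the polynomial ring: the cofactor has integral degree. -/
theorem mem_span_y_iff (J : Set (Fin n)) (f : E2 k n) :
    f ∈ Ideal.span (E2.y k '' J) ↔ ∀ a, coeff a f.1 ≠ 0 → ∃ j ∈ J, yExponent j ≤ a := by
  constructor
  · intro hf
    induction hf using Submodule.span_induction with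
    | mem x hx =>
      obtain ⟨j, hj, rfl⟩ := hx
      intro a ha
      refine ⟨j, hj, ?_⟩
      by_contra h
      exact ha (by simpa using E2.coeff_y_mul_of_not_le j (1 : E2 k n) a h)
    | zero => simp
    | add x y _ _ hx hy =>
      intro a ha
      by_cases hxa : coeff a x.1 = 0
      · exact hy a fun hya => ha (by rw [Subalgebra.coe_add, coeff_add, hxa, hya, add_zero])
      · exact hx a hxa
    | smul r x _ hx =>
      classical
      intro a ha
      rw [smul_eq_mul, Subalgebra.coe_mul, coeff_mul] at ha
      obtain ⟨p, hp, hne⟩ := Finset.exists_ne_zero_of_sum_ne_zero ha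
      obtain ⟨j, hj, hle⟩ := hx p.2 (right_ne_zero_of_mul hne)
      exact ⟨j, hj, hle.trans (le_add_self.trans_eq
        (Finset.HasAntidiagonal.mem_antidiagonal.mp hp))⟩
  · intro h
    rw [E2.as_sum f]
    refine Submodule.sum_mem _ fun a _ => ?_
    have ha := E2.isIntegralExponent f (mem_support_iff.mp a.2)
    obtain ⟨j, hj, hle⟩ := h a.1 (mem_support_iff.mp a.2)
    have hd := ha.tsub (isIntegralExponent_yExponent j) hle
    have hmul : E2.monomial k a.1 ha = E2.monomial k (a.1 - yExponent j) hd * E2.y k j := by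
      rw [E2.y, E2.monomial_mul]
      simp only [tsub_add_cancel_of_le hle]
    rw [hmul, Algebra.smul_def, ← mul_assoc]
    exact Ideal.mul_mem_left _ _ (Ideal.subset_span ⟨j, hj, rfl⟩)

theorem ofList_take_ofFn_y (i : ℕ) :
    Ideal.ofList ((List.ofFn (E2.y k (n := n))).take i) =
      Ideal.span (E2.y k '' {j : Fin n | j.val < i}) := by
  rw [Ideal.ofList]
  congr 1
  ext x
  simp only [Set.mem_ofPred_eq, List.mem_take_iff_getElem, List.getElem_ofFn, List.length_ofFn,
    Set.mem_image]
  constructor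
  · rintro ⟨j, hj, rfl⟩
    exact ⟨⟨j, by omega⟩, by simp; omega, rfl⟩
  · rintro ⟨j, hj, rfl⟩
    exact ⟨j.val, by have := j.2; omega, rfl⟩

theorem E2.isRegular_y : RingTheory.Sequence.IsRegular (E2 k n) (List.ofFn (E2.y k (n := n))) := by
  constructor
  · constructor
    intro i hi
    rw [List.length_ofFn] at hi
    rw [List.getElem_ofFn, ofList_take_ofFn_y, smul_eq_mul, Ideal.mul_top,
      isSMulRegular_quotient_iff_mem_of_smul_mem]
    intro f hf
    rw [smul_eq_mul, mem_span_y_iff] at hf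
    rw [mem_span_y_iff]
    intro a ha
    obtain ⟨j, hj, hle⟩ := hf (yExponent ⟨i, hi⟩ + a) (by rwa [E2.coeff_y_mul])
    refine ⟨j, hj, ?_⟩
    -- Multiplication by `y_i` does not change the exponent of `x_j`, as `j ≠ i`.
    have hne : (⟨i, hi⟩ : Fin n) ≠ j := fun h => by
      rw [← h] at hj
      exact lt_irrefl i hj
    rw [yExponent_le_iff] at hle ⊢
    simpa [yExponent, hne] using hle
  · have h := ofList_take_ofFn_y (k := k) (n := n) n
    rw [List.take_of_length_le (by simp)] at h
    rw [h, smul_eq_mul, Ideal.mul_top]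
    intro htop
    have h1 : (1 : E2 k n) ∈ Ideal.span (E2.y k '' {j : Fin n | j.val < n}) := by
      rw [← htop]; trivial
    rw [mem_span_y_iff] at h1
    obtain ⟨j, -, hj⟩ := h1 0 (by simp)
    rw [yExponent_le_iff] at hj
    exact absurd hj (not_le.mpr (by positivity))

end RegularSequence

/-! ### The Frobenius quotient -/

section Quotient

open MvPolynomial

variable {k : Type u} [Field k] {n : ℕ}

variable (k n) in
/-- The ideal generated by all `y_i`. -/
noncomputable abbrev yIdeal : Ideal (E2 k n) := Ideal.span (Set.range (E2.y k))

theorem mem_yIdeal_iff (f : E2 k n) :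
    f ∈ yIdeal k n ↔ ∀ b : {a : Fin n →₀ ℕ // IsBoxExponent a}, coeff b.1 f.1 = 0 := by
  rw [yIdeal, ← Set.image_univ, mem_span_y_iff]
  constructor
  · intro h b
    by_contra hb
    obtain ⟨j, -, hj⟩ := h b.1 hb
    rw [yExponent_le_iff] at hj
    exact absurd (b.2.2 j) (not_lt.mpr hj)
  · intro h a ha
    obtain ⟨j, hj⟩ := exists_yExponent_le_of_not_isBoxExponent (E2.isIntegralExponent f ha)
      fun hb => ha (h ⟨a, hb⟩)
    exact ⟨j, trivial, hj⟩

variable (k n) in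
/-- The coefficients of an element of `ℰ_n(2)` at the exponents in the box. -/
noncomputable def boxCoeff : E2 k n →ₗ[k] ({a : Fin n →₀ ℕ // IsBoxExponent a} → k) :=
  LinearMap.pi fun b => lcoeff k b.1 ∘ₗ (E2 k n).val.toLinearMap

theorem boxCoeff_apply (f : E2 k n) (b : {a : Fin n →₀ ℕ // IsBoxExponent a}) :
    boxCoeff k n f b = coeff b.1 f.1 := rfl

theorem boxCoeff_boxMonomial (b c : {a : Fin n →₀ ℕ // IsBoxExponent a}) [Decidable (b = c)] :
    boxCoeff k n (E2.boxMonomial k n b) c = if b = c then 1 else 0 := by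
  classical
  rw [boxCoeff_apply, E2.boxMonomial, E2.coe_monomial, coeff_monomial]
  simp [Subtype.ext_iff]

theorem boxCoeff_surjective : Function.Surjective (boxCoeff k n) := by
  classical
  intro v
  refine ⟨∑ b, v b • E2.boxMonomial k n b, funext fun c => ?_⟩
  simp [boxCoeff_boxMonomial]

theorem ker_boxCoeff : LinearMap.ker (boxCoeff k n) = (yIdeal k n).restrictScalars k := by
  ext f
  rw [LinearMap.mem_ker, Submodule.restrictScalars_mem, mem_yIdeal_iff, funext_iff]
  rfl

variable (k n) in
/-- The coordinates on `ℰ_n(2) / (y_1, …, y_n)` given by the monomials in the box. -/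
noncomputable def boxEquiv :
    (E2 k n ⧸ yIdeal k n) ≃ₗ[k] ({a : Fin n →₀ ℕ // IsBoxExponent a} → k) :=
  (Submodule.Quotient.restrictScalarsEquiv k (yIdeal k n)).symm ≪≫ₗ
    Submodule.quotEquivOfEq _ _ ker_boxCoeff.symm ≪≫ₗ
      (boxCoeff k n).quotKerEquivOfSurjective boxCoeff_surjective

theorem boxEquiv_mk (f : E2 k n) (b : {a : Fin n →₀ ℕ // IsBoxExponent a}) :
    boxEquiv k n (Ideal.Quotient.mk _ f) b = coeff b.1 f.1 := rfl

theorem finrank_quotient :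
    Module.finrank k (E2 k n ⧸ yIdeal k n) = 2 ^ (n * (n - 1) / 2) := by
  rw [(boxEquiv k n).finrank_eq, Module.finrank_fintype_fun_eq_card, card_boxExponent]

/-- The elements of degree `m` in the quotient have coordinates only at exponents of degree `m`. -/
theorem weight_eq_of_mem_quotientGrading {m : ℤ} {q : E2 k n ⧸ yIdeal k n}
    (hq : q ∈ quotientGrading (E2Grading k n) (yIdeal k n) m)
    (b : {a : Fin n →₀ ℕ // IsBoxExponent a}) (hb : boxEquiv k n q b ≠ 0) :
    Finsupp.weight (xDegree n) b.1 = (m : ZHalf) := by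
  obtain ⟨f, hf, rfl⟩ := hq
  exact (mem_E2Grading_iff f m).mp hf b.1 hb

instance quotientGrading_gradedMonoid :
    SetLike.GradedMonoid (quotientGrading (E2Grading k n) (yIdeal k n)) where
  one_mem := ⟨1, SetLike.GradedOne.one_mem, rfl⟩
  mul_mem := by
    rintro i j _ _ ⟨f, hf, rfl⟩ ⟨g, hg, rfl⟩
    exact ⟨f * g, SetLike.GradedMul.mul_mem hf hg, map_mul (Ideal.Quotient.mk _) f g⟩

theorem quotientGrading_isInternal :
    DirectSum.IsInternal (quotientGrading (E2Grading k n) (yIdeal k n)) := by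
  apply DirectSum.isInternal_submodule_of_iSupIndep_of_iSup_eq_top
  · intro m
    -- A common element has its coordinates both at degree `m` and away from degree `m`.
    let N : Submodule k (E2 k n ⧸ yIdeal k n) :=
      { carrier := {q | ∀ b : {a : Fin n →₀ ℕ // IsBoxExponent a},
          Finsupp.weight (xDegree n) b.1 = (m : ZHalf) → boxEquiv k n q b = 0}
        zero_mem' := fun b _ => congrFun (boxEquiv k n).map_zero b
        add_mem' := fun hx hy b hb => by rw [map_add, Pi.add_apply, hx b hb, hy b hb, add_zero]
        smul_mem' := fun r x hx b hb => by rw [map_smul, Pi.smul_apply, hx b hb, smul_zero] }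
    have hN : ⨆ (j) (_ : j ≠ m), quotientGrading (E2Grading k n) (yIdeal k n) j ≤ N := by
      refine iSup₂_le fun j hj q hq b hb => ?_
      by_contra hne
      have h := weight_eq_of_mem_quotientGrading hq b hne
      rw [hb, Int.cast_inj] at h
      exact hj h.symm
    rw [Submodule.disjoint_def]
    intro q hq hq'
    rw [← (boxEquiv k n).map_eq_zero_iff]
    funext b
    by_contra hne
    exact hne (hN hq' b (weight_eq_of_mem_quotientGrading hq b hne))
  · rw [eq_top_iff]
    rintro q -
    obtain ⟨f, rfl⟩ := Ideal.Quotient.mk_surjective q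
    rw [E2.as_sum f, map_sum]
    refine Submodule.sum_mem _ fun a _ => ?_
    have ha := E2.isIntegralExponent f (mem_support_iff.mp a.2)
    obtain ⟨m, hm⟩ := ha
    exact Submodule.mem_iSup_of_mem m ⟨_, Submodule.smul_mem _ _ (E2.monomial_mem a.1 _ hm), rfl⟩

variable (k n) in
/-- The dualising element of `ℰ_n(2)`. -/
noncomputable def E2.alpha : E2 k n := E2.monomial k (socleExp n) isBoxExponent_socleExp.1

theorem E2.coe_alpha :
    (E2.alpha k n : MvPolynomial (Fin n) k) = ∏ i, X i ^ socleExponent n i := by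
  rw [E2.alpha, E2.coe_monomial, monomial_eq, Finsupp.prod_fintype _ _ (by simp), C_1, one_mul]
  rfl

variable (n) in
/-- The exponent of the dualising element, as an element of the box. -/
noncomputable def socleBox : {a : Fin n →₀ ℕ // IsBoxExponent a} :=
  ⟨socleExp n, isBoxExponent_socleExp⟩

theorem boxEquiv_alpha (b : {a : Fin n →₀ ℕ // IsBoxExponent a}) [Decidable (socleBox n = b)] :
    boxEquiv k n (Ideal.Quotient.mk _ (E2.alpha k n)) b = if socleBox n = b then 1 else 0 :=
  boxCoeff_boxMonomial (socleBox n) b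

/-- Multiplication by the monomial dual to `b` moves the coefficient at `b` to the coefficient at
the exponent of the dualising element. -/
theorem coeff_mul_boxDual (f : E2 k n) (b : {a : Fin n →₀ ℕ // IsBoxExponent a}) :
    coeff (socleExp n) (f * E2.boxMonomial k n (boxDual b)).1 = coeff b.1 f.1 := by
  rw [← add_boxDual b, Subalgebra.coe_mul, E2.boxMonomial, E2.coe_monomial, coeff_mul_monomial,
    mul_one]

theorem coe_weight_add_boxDual (b : {a : Fin n →₀ ℕ // IsBoxExponent a}) :
    ((Finsupp.weight (xDegree n) b.1 : ZHalf) : ℚ) +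
      ((Finsupp.weight (xDegree n) (boxDual b).1 : ZHalf) : ℚ) =
        ((Finsupp.weight (xDegree n) (socleExp n) : ZHalf) : ℚ) := by
  rw [← add_boxDual b, map_add]
  rfl

/-- The dualising element is the unique monomial of maximal degree in the box. -/
theorem eq_socleBox_of_coe_weight_le (b : {a : Fin n →₀ ℕ // IsBoxExponent a})
    (h : ((Finsupp.weight (xDegree n) (socleExp n) : ZHalf) : ℚ) ≤
      ((Finsupp.weight (xDegree n) b.1 : ZHalf) : ℚ)) : b = socleBox n := by
  have h1 := coe_weight_add_boxDual b
  have h2 := coe_weight_nonneg (boxDual b).1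
  have h3 := eq_zero_of_coe_weight_eq_zero (a := (boxDual b).1) (by linarith)
  have h4 := add_boxDual b
  rw [h3, add_zero] at h4
  exact Subtype.ext h4

variable (k n) in
/-- The linear form on the quotient that takes the coefficient of the dualising element. -/
noncomputable def quotientForm : (E2 k n ⧸ yIdeal k n) →ₗ[k] k :=
  LinearMap.proj (socleBox n) ∘ₗ (boxEquiv k n).toLinearMap

theorem E2.isGradedFrobenius :
    IsGradedFrobenius (quotientGrading (E2Grading k n) (yIdeal k n)) (2 ^ (n + 1) - 2 * n - 2)
      (Ideal.Quotient.mk (yIdeal k n) (E2.alpha k n)) where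
  gradedMonoid := quotientGrading_gradedMonoid
  isInternal := quotientGrading_isInternal
  finite := Module.Finite.equiv (boxEquiv k n).symm
  span_eq := by
    classical
    apply le_antisymm
    · intro q hq
      rw [Submodule.mem_span_singleton]
      refine ⟨boxEquiv k n q (socleBox n), (boxEquiv k n).injective (funext fun b => ?_)⟩
      rw [map_smul, Pi.smul_apply, boxEquiv_alpha]
      split_ifs with h
      · rw [h, smul_eq_mul, mul_one]
      · rw [smul_zero, eq_comm]
        by_contra hne
        refine h (eq_socleBox_of_coe_weight_le b ?_).symm
        rw [weight_eq_of_mem_quotientGrading hq b hne, weight_socleExp]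
    · rw [Submodule.span_singleton_le_iff_mem]
      exact ⟨_, E2.monomial_mem _ _ weight_socleExp, rfl⟩
  exists_form := by
    classical
    refine ⟨quotientForm k n, fun m hm q hq => ?_, ?_, fun q hq => ?_⟩
    · by_contra hne
      have h := weight_eq_of_mem_quotientGrading hq (socleBox n) hne
      rw [socleBox, weight_socleExp, Int.cast_inj] at h
      exact hm h.symm
    · exact (boxEquiv_alpha (socleBox n)).trans (if_pos rfl)
    · obtain ⟨f, rfl⟩ := Ideal.Quotient.mk_surjective q
      rw [Ideal.Quotient.eq_zero_iff_mem, mem_yIdeal_iff]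
      intro b
      rw [← coeff_mul_boxDual f b]
      exact hq (Ideal.Quotient.mk _ (E2.boxMonomial k n (boxDual b)))

/-- Every nonzero element of the quotient has a multiple equal to the dualising element: multiply
by the dual of a monomial of least degree among those that occur in it. -/
theorem exists_mul_eq_alpha {q : E2 k n ⧸ yIdeal k n} (hq : q ≠ 0) :
    ∃ r, q * r = Ideal.Quotient.mk (yIdeal k n) (E2.alpha k n) := by
  classical
  obtain ⟨f, rfl⟩ := Ideal.Quotient.mk_surjective q
  have hne : (Finset.univ.filter fun b : {a : Fin n →₀ ℕ // IsBoxExponent a} =>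
      coeff b.1 f.1 ≠ 0).Nonempty := by
    by_contra hempty
    refine hq (Ideal.Quotient.eq_zero_iff_mem.mpr ((mem_yIdeal_iff f).mpr fun b => ?_))
    by_contra hb
    exact hempty ⟨b, by simpa using hb⟩
  obtain ⟨b, hb, hmin⟩ := Finset.exists_min_image _
    (fun b => ((Finsupp.weight (xDegree n) b.1 : ZHalf) : ℚ)) hne
  simp only [Finset.mem_filter, Finset.mem_univ, true_and] at hb hmin
  refine ⟨Ideal.Quotient.mk _ ((coeff b.1 f.1)⁻¹ • E2.boxMonomial k n (boxDual b)),
    (boxEquiv k n).injective (funext fun c => ?_)⟩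
  rw [← map_mul, boxEquiv_mk, boxEquiv_alpha, mul_smul_comm, Subalgebra.coe_smul, coeff_smul,
    smul_eq_mul]
  split_ifs with hc
  · rw [← hc]
    change _ * coeff (socleExp n) _ = 1
    rw [coeff_mul_boxDual, inv_mul_cancel₀ hb]
  · rw [Subalgebra.coe_mul, E2.boxMonomial, E2.coe_monomial, coeff_mul_monomial', mul_one]
    split_ifs with hle
    · rw [mul_eq_zero]
      right
      by_contra hne'
      have hbox : IsBoxExponent (c.1 - (boxDual b).1) :=
        ⟨E2.isIntegralExponent f hne', fun i => (Nat.sub_le _ _).trans_lt (c.2.2 i)⟩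
      have h1 := hmin ⟨_, hbox⟩ hne'
      refine hc (eq_socleBox_of_coe_weight_le c ?_).symm
      have h2 := coe_weight_add_boxDual b
      have h3 : ((Finsupp.weight (xDegree n) c.1 : ZHalf) : ℚ) =
          ((Finsupp.weight (xDegree n) (c.1 - (boxDual b).1) : ZHalf) : ℚ) +
            ((Finsupp.weight (xDegree n) (boxDual b).1 : ZHalf) : ℚ) := by
        rw [← Subring.coe_add, ← map_add, tsub_add_cancel_of_le hle]
      dsimp only at h1
      linarith
    · rw [mul_zero]

/-- In a ring all of whose nonzero elements divide a fixed nonzero element, this element generates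
the only minimal nonzero ideal. -/
theorem ringSocle_eq_span_singleton {A : Type*} [CommRing A] {x : A} (hx : x ≠ 0)
    (h : ∀ a : A, a ≠ 0 → a ∣ x) : ringSocle A = Ideal.span {x} := by
  have hle (I : Ideal A) (hI : I ≠ ⊥) : Ideal.span {x} ≤ I := by
    obtain ⟨a, ha, ha0⟩ := Submodule.exists_mem_ne_zero_of_ne_bot hI
    rw [Ideal.span_singleton_le_iff_mem]
    exact Ideal.mem_of_dvd I (h a ha0) ha
  have hatom : IsAtom (Ideal.span {x}) := by
    refine ⟨by simpa [Ideal.span_singleton_eq_bot] using hx, fun I hI => ?_⟩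
    by_contra hne
    exact absurd (hle I hne) (not_le_of_gt hI)
  apply le_antisymm
  · refine sSup_le fun I hI => ?_
    have hI' : IsAtom I := isSimpleModule_iff_isAtom.mp hI
    rw [hI'.le_iff.mp (hle I hI'.1) |>.resolve_left hatom.1]
  · exact le_sSup (isSimpleModule_iff_isAtom.mpr hatom)

theorem E2.ringSocle_quotient : ringSocle (E2 k n ⧸ yIdeal k n) =
    Ideal.span {Ideal.Quotient.mk (yIdeal k n) (E2.alpha k n)} := by
  classical
  refine ringSocle_eq_span_singleton (fun h => ?_) fun q hq => ?_
  · have h1 := boxEquiv_alpha (k := k) (socleBox n)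
    rw [h, LinearEquiv.map_zero, if_pos rfl] at h1
    exact zero_ne_one h1
  · obtain ⟨r, hr⟩ := exists_mul_eq_alpha hq
    exact ⟨r, hr.symm⟩

end Quotient

/-! ### The Poincaré series -/

section Poincare

open MvPolynomial

variable {k : Type u} [Field k] {n : ℕ}

variable (k n) in
/-- The monomials of degree `m` form a basis of the homogeneous part of degree `m`. -/
noncomputable def E2Grading.basis (m : ℤ) :
    Module.Basis {a : Fin n →₀ ℕ | Finsupp.weight (xDegree n) a = (m : ZHalf)} k
      (E2Grading k n m) :=
  (basisRestrictSupport k {a : Fin n →₀ ℕ | Finsupp.weight (xDegree n) a = (m : ZHalf)}).map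
    ((Submodule.equivMapOfInjective (E2 k n).val.toLinearMap Subtype.val_injective
      (E2Grading k n m)).trans (LinearEquiv.ofEq _ _ (by
        ext f
        rw [mem_restrictSupport_iff]
        constructor
        · rintro ⟨g, hg, rfl⟩ a ha
          exact (mem_E2Grading_iff g m).mp hg a (mem_support_iff.mp ha)
        · intro h
          have h' (a : Fin n →₀ ℕ) (ha : coeff a f ≠ 0) :
              Finsupp.weight (xDegree n) a = (m : ZHalf) := h (mem_support_iff.mpr ha)
          exact ⟨⟨f, (mem_integralPart_iff f).mpr fun a ha => ⟨m, h' a ha⟩⟩,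
            (mem_E2Grading_iff _ m).mpr h', rfl⟩))).symm

theorem E2Grading.finite (m : ℤ) : Module.Finite k (E2Grading k n m) := by
  have := (finite_setOf_weight_eq (n := n) (m : ZHalf)).to_subtype
  exact Module.Finite.of_basis (E2Grading.basis k n m)

theorem E2Grading.finrank (m : ℤ) : Module.finrank k (E2Grading k n m) =
    {a : Fin n →₀ ℕ | Finsupp.weight (xDegree n) a = (m : ZHalf)}.ncard :=
  Module.finrank_eq_nat_card_basis (E2Grading.basis k n m)

variable (n) in
/-- The exponents of degree `d` whose first `j` coordinates are those of an exponent in the box. -/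
def partialBox (j d : ℕ) : Set (Fin n →₀ ℕ) :=
  {a | Finsupp.weight (xDegree n) a = ((d : ℤ) : ZHalf) ∧
    ∀ i : Fin n, i.val < j → a i < 2 ^ (i.val + 1)}

theorem finite_partialBox (j d : ℕ) : (partialBox n j d).Finite :=
  (finite_setOf_weight_eq _).subset fun _ ha => ha.1

theorem coe_weight_of_mem_partialBox {j d : ℕ} {a : Fin n →₀ ℕ} (ha : a ∈ partialBox n j d) :
    ((Finsupp.weight (xDegree n) a : ZHalf) : ℚ) = d :=
  (weight_eq_intCast_iff a d).mp ha.1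

theorem coe_weight_yExponent (i : Fin n) :
    ((Finsupp.weight (xDegree n) (yExponent i) : ZHalf) : ℚ) = (2 ^ (i.val + 1) - 1 : ℕ) := by
  rw [(weight_eq_intCast_iff _ _).mp (weight_yExponent i), Nat.cast_sub Nat.one_le_two_pow]
  push_cast
  rfl

theorem coe_weight_yExponent_add (i : Fin n) (a : Fin n →₀ ℕ) :
    ((Finsupp.weight (xDegree n) (yExponent i + a) : ZHalf) : ℚ) =
      (2 ^ (i.val + 1) - 1 : ℕ) + ((Finsupp.weight (xDegree n) a : ZHalf) : ℚ) := by
  rw [map_add, Subring.coe_add, coe_weight_yExponent]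

/-- The exponents that are not yet bounded in the coordinate `j` are the translates by the exponent
of `y_j` of exponents of smaller degree. -/
theorem ncard_partialBox (j : Fin n) (d : ℕ) :
    (partialBox n j d).ncard = (partialBox n (j + 1) d).ncard +
      if 2 ^ (j.val + 1) - 1 ≤ d then (partialBox n j (d - (2 ^ (j.val + 1) - 1))).ncard
      else 0 := by
  have hunion : partialBox n j d =
      partialBox n (j + 1) d ∪ (partialBox n j d ∩ {a | yExponent j ≤ a}) := by
    ext a
    constructor
    · intro ha
      by_cases hj : yExponent j ≤ a
      · exact Or.inr ⟨ha, hj⟩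
      · refine Or.inl ⟨ha.1, fun i hi => ?_⟩
        rcases Nat.lt_succ_iff_lt_or_eq.mp hi with h | h
        · exact ha.2 i h
        · obtain rfl := Fin.ext h
          simpa [yExponent_le_iff] using hj
    · rintro (ha | ha)
      · exact ⟨ha.1, fun i hi => ha.2 i (Nat.lt_succ_of_lt hi)⟩
      · exact ha.1
  have hdisj : Disjoint (partialBox n (j + 1) d) (partialBox n j d ∩ {a | yExponent j ≤ a}) := by
    rw [Set.disjoint_left]
    rintro a ha ⟨-, ha'⟩
    exact absurd ((yExponent_le_iff j a).mp ha') (not_le.mpr (ha.2 j (Nat.lt_succ_self _)))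
  have hcard := Set.ncard_union_eq hdisj (finite_partialBox _ _)
    ((finite_partialBox j d).subset Set.inter_subset_left)
  rw [← hunion] at hcard
  rw [hcard]
  congr 1
  split_ifs with h
  · have himage : partialBox n j d ∩ {a | yExponent j ≤ a} =
        (yExponent j + ·) '' partialBox n j (d - (2 ^ (j.val + 1) - 1)) := by
      ext a
      constructor
      · rintro ⟨ha, ha'⟩
        refine ⟨a - yExponent j, ⟨?_, fun i hi => (Nat.sub_le _ _).trans_lt (ha.2 i hi)⟩,
          add_tsub_cancel_of_le ha'⟩
        have h1 := coe_weight_yExponent_add j (a - yExponent j)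
        rw [add_tsub_cancel_of_le ha', coe_weight_of_mem_partialBox ha] at h1
        rw [weight_eq_intCast_iff, Int.cast_natCast, Nat.cast_sub h, h1]
        ring
      · rintro ⟨b, hb, rfl⟩
        refine ⟨⟨?_, fun i hi => ?_⟩, (le_self_add : yExponent j ≤ yExponent j + b)⟩
        · rw [weight_eq_intCast_iff, coe_weight_yExponent_add, coe_weight_of_mem_partialBox hb,
            Int.cast_natCast, Nat.cast_sub h]
          ring
        · have hne : j ≠ i := fun h => by rw [h] at hi; exact lt_irrefl _ hi
          simpa [yExponent, hne] using hb.2 i hi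
    rw [himage, Set.ncard_image_of_injective _ (add_right_injective _)]
  · rw [Set.ncard_eq_zero ((finite_partialBox _ _).subset Set.inter_subset_left)]
    rw [Set.eq_empty_iff_forall_notMem]
    rintro a ⟨ha, ha'⟩
    have h1 := coe_weight_yExponent_add j (a - yExponent j)
    rw [add_tsub_cancel_of_le ha', coe_weight_of_mem_partialBox ha] at h1
    have h2 := coe_weight_nonneg (a - yExponent j)
    refine h ?_
    have h3 : ((2 ^ (j.val + 1) - 1 : ℕ) : ℚ) ≤ d := by linarith
    exact_mod_cast h3

variable (n) in
/-- The generating function of the number of exponents in `partialBox n j d`. -/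
noncomputable def partialSeries (j : ℕ) : PowerSeries ℚ :=
  PowerSeries.mk fun d => ((partialBox n j d).ncard : ℚ)

theorem partialSeries_zero : partialSeries n 0 = poincareSeries (E2Grading k n) := by
  ext d
  rw [partialSeries, poincareSeries, PowerSeries.coeff_mk, PowerSeries.coeff_mk, E2Grading.finrank]
  congr 3
  ext a
  simp [partialBox]

theorem partialSeries_succ (j : Fin n) : partialSeries n (j + 1) =
    (1 - PowerSeries.X ^ (2 ^ (j.val + 1) - 1)) * partialSeries n j := by
  ext d
  rw [sub_mul, one_mul, map_sub, PowerSeries.coeff_X_pow_mul', partialSeries, partialSeries,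
    PowerSeries.coeff_mk, PowerSeries.coeff_mk, PowerSeries.coeff_mk, ncard_partialBox j d]
  split_ifs <;> push_cast <;> ring

variable (n) in
/-- The denominator `∏ (1 - q ^ (2 ^ i - 1))` of the Poincaré series. -/
noncomputable def poincareDenom : Polynomial ℚ :=
  ∏ i ∈ Finset.range n, (1 - Polynomial.X ^ (2 ^ (i + 1) - 1))

theorem partialSeries_eq_mul {j : ℕ} (hj : j ≤ n) :
    partialSeries n j = ((∏ i ∈ Finset.range j, (1 - Polynomial.X ^ (2 ^ (i + 1) - 1)) :
      Polynomial ℚ) : PowerSeries ℚ) * partialSeries n 0 := by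
  induction j with
  | zero => simp
  | succ j ih =>
    rw [Finset.prod_range_succ, Polynomial.coe_mul, mul_right_comm, ← ih (Nat.le_of_succ_le hj),
      partialSeries_succ ⟨j, hj⟩]
    simp [mul_comm]

/-- The degree of a monomial in the box, which is a nonnegative integer, as a natural number. -/
noncomputable def boxDegree (b : {a : Fin n →₀ ℕ // IsBoxExponent a}) : ℕ :=
  b.2.1.choose.toNat

theorem coe_boxDegree (b : {a : Fin n →₀ ℕ // IsBoxExponent a}) :
    (boxDegree b : ℚ) = ((Finsupp.weight (xDegree n) b.1 : ZHalf) : ℚ) := by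
  have h := (weight_eq_intCast_iff _ _).mp b.2.1.choose_spec
  have h0 : 0 ≤ b.2.1.choose := by
    have := coe_weight_nonneg b.1
    rw [h] at this
    exact_mod_cast this
  rw [h, boxDegree]
  exact_mod_cast Int.toNat_of_nonneg h0

theorem boxDegree_add_boxDual (b : {a : Fin n →₀ ℕ // IsBoxExponent a}) :
    boxDegree b + boxDegree (boxDual b) = boxDegree (socleBox n) := by
  have h := coe_weight_add_boxDual b
  have h' := coe_boxDegree (socleBox n)
  rw [socleBox] at h'
  rw [← coe_boxDegree, ← coe_boxDegree, ← h'] at h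
  exact_mod_cast h

variable (n) in
/-- The numerator of the Poincaré series: the Hilbert polynomial of the Frobenius quotient. -/
noncomputable def poincareNum : Polynomial ℚ :=
  ∑ b : {a : Fin n →₀ ℕ // IsBoxExponent a}, Polynomial.X ^ boxDegree b

theorem partialSeries_self : partialSeries n n = (poincareNum n : PowerSeries ℚ) := by
  classical
  ext d
  rw [partialSeries, PowerSeries.coeff_mk, Polynomial.coeff_coe, poincareNum,
    Polynomial.finsetSum_coeff]
  simp only [Polynomial.coeff_X_pow, Finset.sum_boole]
  have himage : partialBox n n d =
      Subtype.val '' (↑(Finset.univ.filter fun b : {a : Fin n →₀ ℕ // IsBoxExponent a} =>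
        d = boxDegree b) : Set {a : Fin n →₀ ℕ // IsBoxExponent a}) := by
    ext a
    simp only [Finset.coe_filter, Finset.mem_univ, true_and, Set.mem_image, Set.mem_ofPred_eq]
    constructor
    · intro ha
      refine ⟨⟨a, ⟨_, ha.1⟩, fun i => ha.2 i i.2⟩, ?_, rfl⟩
      have h := coe_boxDegree ⟨a, ⟨_, ha.1⟩, fun i => ha.2 i i.2⟩
      rw [coe_weight_of_mem_partialBox ha] at h
      exact_mod_cast h.symm
    · rintro ⟨b, rfl, rfl⟩
      refine ⟨?_, fun i _ => b.2.2 i⟩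
      rw [weight_eq_intCast_iff, ← coe_boxDegree, Int.cast_natCast]
  rw [himage, Set.ncard_image_of_injective _ Subtype.val_injective, Set.ncard_coe_finset]

theorem poincareDenom_mul_poincareSeries :
    (poincareDenom n : PowerSeries ℚ) * poincareSeries (E2Grading k n) = poincareNum n := by
  rw [← partialSeries_zero, poincareDenom, ← partialSeries_eq_mul le_rfl, partialSeries_self]

theorem poincareDenom_ne_zero : poincareDenom n ≠ 0 := by
  rw [poincareDenom, Finset.prod_ne_zero_iff]
  intro i _ h
  have h1 := congrArg (Polynomial.eval 0) h
  have h2 : 2 ^ (i + 1) - 1 ≠ 0 := by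
    have := Nat.one_lt_two_pow (n := i + 1) (Nat.succ_ne_zero _)
    omega
  simp [h2] at h1

/-- The numerator is palindromic. -/
theorem pow_mul_poincareNum_inv {K : Type*} [Field K] (φ : ℚ →+* K) {x : K} (hx : x ≠ 0) :
    x ^ boxDegree (socleBox n) * (poincareNum n).eval₂ φ x⁻¹ = (poincareNum n).eval₂ φ x := by
  have hbij : Function.Bijective (boxDual (n := n)) :=
    Function.Involutive.bijective boxDual_boxDual
  simp only [poincareNum, Polynomial.eval₂_finsetSum, Polynomial.eval₂_X_pow, Finset.mul_sum]
  rw [← hbij.sum_comp fun b => x ^ boxDegree b]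
  refine Finset.sum_congr rfl fun b _ => ?_
  rw [← boxDegree_add_boxDual b, pow_add, inv_pow]
  field_simp

theorem pow_mul_poincareDenom_inv {K : Type*} [Field K] (φ : ℚ →+* K) {x : K} (hx : x ≠ 0) :
    x ^ (boxDegree (socleBox n) + n) * (poincareDenom n).eval₂ φ x⁻¹ =
      (-1) ^ n * (poincareDenom n).eval₂ φ x := by
  have hdeg : boxDegree (socleBox n) + n = ∑ i ∈ Finset.range n, (2 ^ (i + 1) - 1) := by
    have h1 : (boxDegree (socleBox n) : ℚ) = 2 ^ (n + 1) - 2 * n - 2 :=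
      (coe_boxDegree _).trans coe_weight_socleExp
    have h2 : ((∑ i ∈ Finset.range n, (2 ^ (i + 1) - 1) : ℕ) : ℚ) = 2 ^ (n + 1) - 2 - n := by
      clear h1 hx
      induction n with
      | zero => norm_num
      | succ n ih =>
        rw [Finset.sum_range_succ, Nat.cast_add, ih, Nat.cast_sub Nat.one_le_two_pow]
        push_cast
        ring
    have h3 : ((boxDegree (socleBox n) + n : ℕ) : ℚ) =
        ((∑ i ∈ Finset.range n, (2 ^ (i + 1) - 1) : ℕ) : ℚ) := by
      rw [h2, Nat.cast_add, h1]; ring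
    exact_mod_cast h3
  rw [hdeg, poincareDenom, Polynomial.eval₂_finsetProd, Polynomial.eval₂_finsetProd,
    ← Finset.prod_pow_eq_pow_sum, ← Finset.prod_mul_distrib]
  have hsign : (-1 : K) ^ n = ∏ _i ∈ Finset.range n, (-1 : K) := by
    rw [Finset.prod_const, Finset.card_range]
  rw [hsign, ← Finset.prod_mul_distrib]
  refine Finset.prod_congr rfl fun i _ => ?_
  simp only [Polynomial.eval₂_sub, Polynomial.eval₂_one, Polynomial.eval₂_X_pow, inv_pow]
  rw [mul_sub, mul_one, mul_inv_cancel₀ (pow_ne_zero _ hx)]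
  ring

theorem exists_ratFunc_poincareSeries : ∃ f : RatFunc ℚ,
    (f.denom : PowerSeries ℚ) * poincareSeries (E2Grading k n) = (f.num : PowerSeries ℚ) ∧
    RatFunc.eval RatFunc.C (RatFunc.X⁻¹ : RatFunc ℚ) f = (-RatFunc.X) ^ n * f := by
  let f : RatFunc ℚ := algebraMap _ _ (poincareNum n) / algebraMap _ _ (poincareDenom n)
  have hD := poincareDenom_ne_zero (n := n)
  have hf : f.num * poincareDenom n = poincareNum n * f.denom :=
    (RatFunc.num_mul_eq_mul_denom_iff hD).mpr rfl
  refine ⟨f, ?_, ?_⟩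
  · have hD' : (poincareDenom n : PowerSeries ℚ) ≠ 0 := by
      rwa [Ne, Polynomial.coe_eq_zero_iff]
    apply mul_left_cancel₀ hD'
    rw [mul_left_comm, poincareDenom_mul_poincareSeries, ← Polynomial.coe_mul,
      ← Polynomial.coe_mul, mul_comm, ← hf, mul_comm]
  · have hX : (RatFunc.X : RatFunc ℚ) ≠ 0 := RatFunc.X_ne_zero
    have heval (p : Polynomial ℚ) :
        p.eval₂ RatFunc.C (RatFunc.X : RatFunc ℚ) = algebraMap _ _ p := by
      have h : Polynomial.eval₂RingHom RatFunc.C (RatFunc.X : RatFunc ℚ) = algebraMap _ _ :=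
        Polynomial.ringHom_ext (by simp) (by simp)
      exact RingHom.congr_fun h p
    have hN := pow_mul_poincareNum_inv (n := n) RatFunc.C hX
    have hDen := pow_mul_poincareDenom_inv (n := n) RatFunc.C hX
    rw [heval] at hN hDen
    have hDalg : algebraMap (Polynomial ℚ) (RatFunc ℚ) (poincareDenom n) ≠ 0 :=
      RatFunc.algebraMap_ne_zero hD
    have hDinv : (poincareDenom n).eval₂ RatFunc.C (RatFunc.X : RatFunc ℚ)⁻¹ ≠ 0 := by
      intro h
      rw [h, mul_zero] at hDen
      exact mul_ne_zero (pow_ne_zero n (neg_ne_zero.mpr one_ne_zero)) hDalg hDen.symm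
    have hdenom : f.denom.eval₂ RatFunc.C (RatFunc.X : RatFunc ℚ)⁻¹ ≠ 0 := by
      obtain ⟨q, hq⟩ := RatFunc.denom_div_dvd (poincareNum n) (poincareDenom n)
      intro h
      apply hDinv
      rw [hq, Polynomial.eval₂_mul]
      exact mul_eq_zero_of_left h _
    have hf' := congrArg (Polynomial.eval₂ RatFunc.C (RatFunc.X : RatFunc ℚ)⁻¹) hf
    rw [Polynomial.eval₂_mul, Polynomial.eval₂_mul] at hf'
    rw [RatFunc.eval, div_eq_iff hdenom]
    apply mul_right_cancel₀ hDinv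
    rw [hf']
    change _ = (-RatFunc.X) ^ n * (algebraMap _ _ (poincareNum n) /
      algebraMap _ _ (poincareDenom n)) * _ * _
    rw [mul_right_comm]
    have hsign : (-1 : RatFunc ℚ) ^ n * (-1) ^ n = 1 := by rw [← mul_pow]; simp
    congr 1
    rw [mul_div_assoc', div_mul_eq_mul_div, eq_div_iff hDalg, neg_pow]
    generalize (poincareNum n).eval₂ RatFunc.C (RatFunc.X : RatFunc ℚ)⁻¹ = N' at hN ⊢
    generalize (poincareDenom n).eval₂ RatFunc.C (RatFunc.X : RatFunc ℚ)⁻¹ = D' at hDen ⊢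
    linear_combination (-1) ^ n * RatFunc.X ^ n * D' * hN - (-1) ^ n * N' * hDen -
      N' * algebraMap (Polynomial ℚ) (RatFunc ℚ) (poincareDenom n) * hsign

end Poincare

theorem mainTheorem3 (k : Type u) [Field k] [CharP k 2] (n : ℕ) :
    IsDomain (E2 k n) ∧
    IsGorensteinRing (E2 k n) ∧
    (∃ (y : Fin n → E2 k n) (α : E2 k n),
      (∀ i, (y i : MvPolynomial (Fin n) k) = MvPolynomial.X i ^ 2 ^ (i.val + 1)) ∧
      (α : MvPolynomial (Fin n) k) = ∏ i, MvPolynomial.X i ^ socleExponent n i ∧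
      IsHomogeneousSystemOfParameters (E2Grading k n) y (fun i => 2 ^ (i.val + 1) - 1) ∧
      RingTheory.Sequence.IsRegular (E2 k n) (List.ofFn y) ∧
      Module.finrank k (E2 k n ⧸ Ideal.span (Set.range y)) = 2 ^ (n * (n - 1) / 2) ∧
      IsGradedFrobenius (quotientGrading (E2Grading k n) (Ideal.span (Set.range y)))
        (2 ^ (n + 1) - 2 * n - 2) (Ideal.Quotient.mk (Ideal.span (Set.range y)) α) ∧
      ringSocle (E2 k n ⧸ Ideal.span (Set.range y)) =
        Ideal.span {Ideal.Quotient.mk (Ideal.span (Set.range y)) α}) ∧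
    (∀ m : ℤ, Module.Finite k (E2Grading k n m)) ∧
    ∃ f : RatFunc ℚ,
      (f.denom : PowerSeries ℚ) * poincareSeries (E2Grading k n) = (f.num : PowerSeries ℚ) ∧
      RatFunc.eval RatFunc.C (RatFunc.X⁻¹ : RatFunc ℚ) f = (-RatFunc.X) ^ n * f :=
  ⟨inferInstance, E2.isGorensteinRing,
    ⟨E2.y k, E2.alpha k n, E2.coe_y, E2.coe_alpha, E2.isHomogeneousSystemOfParameters,
      E2.isRegular_y, finrank_quotient, E2.isGradedFrobenius, E2.ringSocle_quotient⟩,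
    E2Grading.finite, exists_ratFunc_poincareSeries⟩
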